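/- Let $n\ge 2$ and $k\ge 1$ be integers, and let $\mathcal L\subset\mathbb R^n$ be a full-rank lattice that is integral, i.e. $\langle x,y\rangle\in\mathbb Z$ for all $x,y\in\mathcal L$. Suppose that $$\bigl|\{y\in\mathcal L:\|y\|^2=k\}\bigr| = 2\binom{n+2k-2}{2k-1},$$ and put $X=\tfrac1{\sqrt k}\{y\in\mathcal L:\|y\|^2=k\}\subset S^{n-1}$ and $A(X)=\{\langle x,y\rangle : x,y\in X,\ x\neq y\}$. A finite nonempty set $Y\subset S^{n-1}$ is a spherical $t$-design if $\frac1{|Y|}\sum_{x\in Y}f(x)=\int_{S^{n-1}}f\,d\sigma$ for every real polynomial $f$ on $\mathbb R^n$ of total degree at most $t$, where $\sigma$ is the normalized rotation-invariant measure on $S^{n-1}$. It is tight if moreover $|Y|=\binom{n+e-1}{e}+\binom{n+e-2}{e-1}$ when $t=2e$ (the second term being $0$ for $e=0$), respectively $|Y|=2\binom{n+e-1}{e}$ when $t=2e+1$. Let $Q_i^{(n)}$ be the Gegenbauer polynomials normalized by $Q_i^{(n)}(1)=\dim\operatorname{Harm}_i(\mathbb R^n)$, that is, $Q_0^{(n)}=1$,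 $Q_1^{(n)}(u)=nu$ and $$\lambda_{i+2}Q_{i+2}^{(n)}(u)=u\,Q_{i+1}^{(n)}(u)-(1-\lambda_i)Q_i^{(n)}(u)\quad(i\ge0),\qquad \lambda_0=0,\quad \lambda_i=\frac{i}{n+2i-2}\ (i\ge1),$$ and let $\mathcal C_m^{(n)}=Q_m^{(n)}+Q_{m-2}^{(n)}+Q_{m-4}^{(n)}+\cdots$, the sum ending in $Q_0^{(n)}$ or $Q_1^{(n)}$ according to the parity of $m$. Then: 1. $A(X)=\{-1\}\cup\{j/k : j\in\mathbb Z,\ -k<j<k\}$. 2. $X$ is antipodal ($X=-X$) and is a tight spherical $(4k-1)$-design. 3. With $F_X(u)=\prod_{\alpha\in A(X)}\frac{u-\alpha}{1-\alpha}$, one has the polynomial identity $$2\binom{n+2k-2}{2k-1}F_X(u)=(1+u)\,\mathcal C_{2k-1}^{(n)}(u).$$ 4. The set of (complex) roots of $\mathcal C_{2k-1}^{(n)}$ is exactly $\left\{0,\pm\frac1k,\pm\frac2k,\ldots,\pm\frac{k-1}{k}\right\}$. -/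

import Mathlib

open MeasureTheory Polynomial
open scoped Pointwise RealInnerProductSpace

noncomputable section

namespace LatticeShell

/-- A lattice is integral if all inner products of its vectors are integers. -/
def IsIntegralLattice {n : ℕ} (L : Submodule ℤ (EuclideanSpace ℝ (Fin n))) : Prop :=
  ∀ x ∈ L, ∀ y ∈ L, ∃ m : ℤ, ⟪x, y⟫ = (m : ℝ)

/-- The norm-`k` shell: lattice vectors of squared length `k`. -/
def shell {n : ℕ} (L : Submodule ℤ (EuclideanSpace ℝ (Fin n))) (k : ℕ) :
    Set (EuclideanSpace ℝ (Fin n)) :=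
  {y | y ∈ L ∧ ‖y‖ ^ 2 = (k : ℝ)}

/-- The normalized norm-`k` shell, the shell scaled by `1 / √k`. -/
def normalizedShell {n : ℕ} (L : Submodule ℤ (EuclideanSpace ℝ (Fin n))) (k : ℕ) :
    Set (EuclideanSpace ℝ (Fin n)) :=
  (1 / Real.sqrt (k : ℝ)) • shell L k

/-- A set is antipodal if it equals its negative. -/
def IsAntipodal {n : ℕ} (X : Set (EuclideanSpace ℝ (Fin n))) : Prop :=
  X = -X

/-- The set of inner products of distinct elements. -/
def innerProductSet {n : ℕ} (X : Set (EuclideanSpace ℝ (Fin n))) : Set ℝ :=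
  {a | ∃ x ∈ X, ∃ y ∈ X, x ≠ y ∧ a = ⟪x, y⟫}

/-- The surface measure of the unit sphere, normalized to total mass one. -/
def sphereMeasure (n : ℕ) : Measure (Metric.sphere (0 : EuclideanSpace ℝ (Fin n)) 1) :=
  ((volume : Measure (EuclideanSpace ℝ (Fin n))).toSphere Set.univ)⁻¹ •
    (volume : Measure (EuclideanSpace ℝ (Fin n))).toSphere

/-- Spherical `t`-designs: finite nonempty subsets of the unit sphere over which every polynomial
of total degree at most `t` has the same average as over the whole sphere. -/
structure IsSphericalDesign {n : ℕ} (t : ℕ) (X : Set (EuclideanSpace ℝ (Fin n))) : Prop where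
  finite : X.Finite
  nonempty : X.Nonempty
  subset_sphere : X ⊆ Metric.sphere 0 1
  average_eq : ∀ f : MvPolynomial (Fin n) ℝ, f.totalDegree ≤ t →
    (1 / (X.ncard : ℝ)) * ∑ᶠ x ∈ X, MvPolynomial.eval (fun i => x i) f =
      ∫ u : Metric.sphere (0 : EuclideanSpace ℝ (Fin n)) 1,
        MvPolynomial.eval (fun i => (u : EuclideanSpace ℝ (Fin n)) i) f ∂(sphereMeasure n)

/-- The Fisher-type lower bound for the size of a spherical `t`-design in dimension `n`:
`binom(n+e-1, e) + binom(n+e-2, e-1)` if `t = 2e` (the second term being `0` for `e = 0`), and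
`2 * binom(n+e-1, e)` if `t = 2e+1`. -/
def designBound (n t : ℕ) : ℕ :=
  if Even t then
    (n + t / 2 - 1).choose (t / 2) + (if t = 0 then 0 else (n + t / 2 - 2).choose (t / 2 - 1))
  else 2 * (n + t / 2 - 1).choose (t / 2)

/-- A tight spherical `t`-design: one of the least size allowed by the Fisher-type bound. -/
def IsTightSphericalDesign {n : ℕ} (t : ℕ) (X : Set (EuclideanSpace ℝ (Fin n))) : Prop :=
  IsSphericalDesign t X ∧ X.ncard = designBound n t

/-- The coefficients `λ_i = i / (n + 2i - 2)` of the Gegenbauer recurrence; `λ_0 = 0` for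
every `n`, also for `n = 2`, since Lean's `0 / 0` is `0`. -/
def gegenbauerCoeff (n i : ℕ) : ℝ := (i : ℝ) / ((n : ℝ) + 2 * (i : ℝ) - 2)

/-- The Gegenbauer polynomials `Q_i^{(n)}` in the normalization `Q_i^{(n)}(1) = dim Harm_i(ℝ^n)`,
given by `Q_0 = 1`, `Q_1 = n u` and
`λ_{i+2} Q_{i+2} = u Q_{i+1} - (1 - λ_i) Q_i`. -/
def gegenbauerQ (n : ℕ) : ℕ → ℝ[X]
  | 0 => 1
  | 1 => C (n : ℝ) * X
  | i + 2 => C (gegenbauerCoeff n (i + 2))⁻¹ *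
      (X * gegenbauerQ n (i + 1) - C (1 - gegenbauerCoeff n i) * gegenbauerQ n i)

/-- The cumulative sum `Q_m + Q_{m-2} + Q_{m-4} + ⋯`, ending in `Q_0` or `Q_1`. -/
def gegenbauerSum (n m : ℕ) : ℝ[X] :=
  ∑ j ∈ Finset.range (m / 2 + 1), gegenbauerQ n (m - 2 * j)

/-- The annihilator polynomial `∏ (u - α) / (1 - α)` over the inner products `α` of distinct
elements of `X`. -/
def annihilator {n : ℕ} (X : Set (EuclideanSpace ℝ (Fin n))) : ℝ[X] :=
  ∏ᶠ α ∈ innerProductSet X, C (1 / (1 - α)) * (Polynomial.X - C α)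

end LatticeShell

end

/-!
Let `X` be an antipodal code with cosine set `A` (inner products other than `±1`) and `e = #A`.
The polynomial `g` with roots `A` and `g 1 = 1`, homogenized at the points of a half of `X`, gives
linearly independent forms of degree `e`, so `#X ≤ 2 M` for `M = (n + e - 1).choose e`. In case of
equality these forms are a basis, and `g` reproduces every form of degree `e` from its values
on `X`. This reproducing property makes the power sums `∑ x ∈ X, ⟪v, x⟫ ^ (2 * e)` depend on `‖v‖`
only, and such invariance in degree `2 * e` descends to all lower even degrees: `X` is a
`(2 * e + 1)`-design. Through the design property, `M g` and the Gegenbauer sum `C_e` both represent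
`p ↦ p 1` on polynomials of degree at most `e` and of the parity of `e`, hence their difference has
zero square integral over the sphere and vanishes.

For the shell of an integral lattice, `A` lies among the `2 k - 1` fractions `j / k` in `(-1, 1)`,
and as the bound `2 (n + e - 1).choose e` is strictly increasing in `e`, the assumed cardinality
forces `A` to consist of all of them.
-/

namespace LatticeShell

/-! ### Gegenbauer polynomials -/

theorem gegenbauerCoeff_zero (n : ℕ) : gegenbauerCoeff n 0 = 0 := by simp [gegenbauerCoeff]

theorem gegenbauerCoeff_succ (n i : ℕ) :
    gegenbauerCoeff n (i + 1) = ((i : ℝ) + 1) / ((n : ℝ) + 2 * i) := by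
  simp only [gegenbauerCoeff, Nat.cast_add, Nat.cast_one]
  congr 1
  ring

theorem gegenbauerCoeff_succ_pos {n : ℕ} (hn : 1 ≤ n) (i : ℕ) :
    0 < gegenbauerCoeff n (i + 1) := by
  rw [gegenbauerCoeff_succ]
  positivity

theorem X_mul_gegenbauerQ_zero {n : ℕ} (hn : 1 ≤ n) :
    X * gegenbauerQ n 0 = C (gegenbauerCoeff n 1) * gegenbauerQ n 1 := by
  have hn0 : (n : ℝ) ≠ 0 := by positivity
  have hcoeff : gegenbauerCoeff n 1 * n = 1 := by
    simpa [hn0] using congr_arg (· * (n : ℝ)) (gegenbauerCoeff_succ n 0)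
  rw [gegenbauerQ, gegenbauerQ, ← mul_assoc, ← C_mul, hcoeff, C_1, one_mul, mul_one]

theorem X_mul_gegenbauerQ_succ {n : ℕ} (hn : 1 ≤ n) (i : ℕ) :
    X * gegenbauerQ n (i + 1) = C (gegenbauerCoeff n (i + 2)) * gegenbauerQ n (i + 2) +
      C (1 - gegenbauerCoeff n i) * gegenbauerQ n i := by
  have h := (gegenbauerCoeff_succ_pos hn (i + 1)).ne'
  rw [gegenbauerQ, ← mul_assoc, ← C_mul, mul_inv_cancel₀ h, C_1, one_mul, sub_add_cancel]

theorem gegenbauerQ_comp_neg_X (n i : ℕ) :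
    (gegenbauerQ n i).comp (-X) = (-1) ^ i * gegenbauerQ n i := by
  induction i using Nat.twoStepInduction with
  | zero => simp [gegenbauerQ]
  | one => simp [gegenbauerQ]
  | more i ih1 ih2 =>
    simp only [gegenbauerQ, mul_comp, sub_comp, C_comp, X_comp, ih1, ih2]
    ring

theorem natDegree_gegenbauerQ_le (n i : ℕ) : (gegenbauerQ n i).natDegree ≤ i := by
  induction i using Nat.twoStepInduction with
  | zero => simp [gegenbauerQ]
  | one =>
    rw [gegenbauerQ]
    exact (natDegree_C_mul_le _ _).trans natDegree_X_le
  | more i ih1 ih2 =>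
    rw [gegenbauerQ]
    refine (natDegree_C_mul_le _ _).trans ((natDegree_sub_le _ _).trans (max_le ?_ ?_))
    · exact natDegree_mul_le.trans (by rw [natDegree_X]; omega)
    · exact (natDegree_C_mul_le _ _).trans (by omega)

theorem natDegree_gegenbauerSum_le (n m : ℕ) : (gegenbauerSum n m).natDegree ≤ m :=
  natDegree_sum_le_of_forall_le _ _ fun _ _ =>
    (natDegree_gegenbauerQ_le n _).trans (Nat.sub_le _ _)

theorem gegenbauerSum_add_two (n m : ℕ) :
    gegenbauerSum n (m + 2) = gegenbauerQ n (m + 2) + gegenbauerSum n m := by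
  rw [gegenbauerSum, gegenbauerSum, show (m + 2) / 2 + 1 = (m / 2 + 1) + 1 by omega,
    Finset.sum_range_succ', add_comm]
  congr 1
  exact Finset.sum_congr rfl fun j _ => by congr 1; omega

theorem gegenbauerSum_comp_neg_X (n m : ℕ) :
    (gegenbauerSum n m).comp (-X) = (-1) ^ m * gegenbauerSum n m := by
  induction m using Nat.twoStepInduction with
  | zero => simp [gegenbauerSum, gegenbauerQ]
  | one => simp [gegenbauerSum, gegenbauerQ]
  | more m ih _ =>
    rw [gegenbauerSum_add_two, add_comp, ih, gegenbauerQ_comp_neg_X]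
    ring

/-- The reproducing kernel `Q_0 + ⋯ + Q_m` of the polynomials of degree at most `m` at the
point `1`. -/
noncomputable def gegenbauerKernel (n m : ℕ) : ℝ[X] :=
  ∑ i ∈ Finset.range (m + 1), gegenbauerQ n i

theorem gegenbauerKernel_succ (n m : ℕ) :
    gegenbauerKernel n (m + 1) = gegenbauerKernel n m + gegenbauerQ n (m + 1) :=
  Finset.sum_range_succ _ _

theorem two_mul_gegenbauerSum (n m : ℕ) :
    2 * gegenbauerSum n m =
      gegenbauerKernel n m + (-1) ^ m * (gegenbauerKernel n m).comp (-X) := by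
  induction m using Nat.twoStepInduction with
  | zero => simp [gegenbauerSum, gegenbauerKernel, gegenbauerQ, one_add_one_eq_two]
  | one =>
    have hsum : gegenbauerSum n 1 = C (n : ℝ) * X := by simp [gegenbauerSum, gegenbauerQ]
    have hkernel : gegenbauerKernel n 1 = 1 + C (n : ℝ) * X := by
      simp [gegenbauerKernel, gegenbauerQ, Finset.sum_range_succ]
    rw [hsum, hkernel, add_comp, mul_comp, C_comp, X_comp, one_comp]
    ring
  | more m ih _ =>
    have hsq : ((-1 : ℝ[X]) ^ m) ^ 2 = 1 := by rw [← pow_mul, mul_comm, pow_mul]; simp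
    rw [gegenbauerSum_add_two, mul_add, ih]
    simp only [gegenbauerKernel_succ, add_comp, gegenbauerQ_comp_neg_X]
    linear_combination -(gegenbauerQ n (m + 1 + 1) - gegenbauerQ n (m + 1)) * hsq

/-- The Christoffel–Darboux identity at the point `1`. -/
theorem X_sub_one_mul_gegenbauerKernel {n : ℕ} (hn : 1 ≤ n) (m : ℕ) :
    (X - 1) * gegenbauerKernel n m = C (gegenbauerCoeff n (m + 1)) * gegenbauerQ n (m + 1) -
      C (1 - gegenbauerCoeff n m) * gegenbauerQ n m := by
  induction m with
  | zero =>
    simp only [gegenbauerKernel, zero_add, Finset.sum_range_one, sub_mul,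
      X_mul_gegenbauerQ_zero hn, gegenbauerCoeff_zero, sub_zero, C_1]
  | succ m ih =>
    rw [gegenbauerKernel_succ, mul_add, ih, sub_mul X, X_mul_gegenbauerQ_succ hn m]
    simp only [C_sub, C_1]
    ring

/-- The Gegenbauer polynomials in the classical ultraspherical normalization (up to a factor
depending only on `n`), in which the derivative relations have integral coefficients. The index
is shifted: `ultraspherical n i` is a multiple of `Q_{i+1}`. -/
noncomputable def ultraspherical (n i : ℕ) : ℝ[X] :=
  C ((n : ℝ) + 2 * i)⁻¹ * gegenbauerQ n (i + 1)

theorem gegenbauerQ_succ_eq {n : ℕ} (hn : 1 ≤ n) (i : ℕ) :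
    gegenbauerQ n (i + 1) = C ((n : ℝ) + 2 * i) * ultraspherical n i := by
  rw [ultraspherical, ← mul_assoc, ← C_mul, mul_inv_cancel₀ (by positivity), C_1, one_mul]

theorem ultraspherical_zero {n : ℕ} (hn : 1 ≤ n) : ultraspherical n 0 = X := by
  have hn0 : (n : ℝ) ≠ 0 := by positivity
  rw [ultraspherical, gegenbauerQ, Nat.cast_zero, mul_zero, add_zero, ← mul_assoc, ← C_mul,
    inv_mul_cancel₀ hn0, C_1, one_mul]

theorem C_gegenbauerCoeff_mul_gegenbauerQ_succ {n : ℕ} (hn : 1 ≤ n) (i : ℕ) :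
    C (gegenbauerCoeff n (i + 1)) * gegenbauerQ n (i + 1) =
      ((i : ℝ[X]) + 1) * ultraspherical n i := by
  have hcoeff : gegenbauerCoeff n (i + 1) * ((n : ℝ) + 2 * i) = i + 1 := by
    rw [gegenbauerCoeff_succ, div_mul_cancel₀ _ (by positivity)]
  rw [gegenbauerQ_succ_eq hn, ← mul_assoc, ← C_mul, hcoeff]
  simp

theorem two_mul_ultraspherical_one {n : ℕ} (hn : 1 ≤ n) :
    2 * ultraspherical n 1 = (n : ℝ[X]) * X ^ 2 - 1 := by
  have hrec := X_mul_gegenbauerQ_succ hn 0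
  rw [C_gegenbauerCoeff_mul_gegenbauerQ_succ hn, gegenbauerCoeff_zero, gegenbauerQ,
    gegenbauerQ] at hrec
  simp only [Nat.cast_one, sub_zero, C_1, map_natCast] at hrec
  linear_combination -hrec

theorem ultraspherical_add_two {n : ℕ} (hn : 1 ≤ n) (i : ℕ) :
    ((i : ℝ[X]) + 3) * ultraspherical n (i + 2) =
      ((n : ℝ[X]) + 2 * (i : ℝ[X]) + 2) * X * ultraspherical n (i + 1) -
        ((n : ℝ[X]) + (i : ℝ[X]) - 1) * ultraspherical n i := by
  have hrec := X_mul_gegenbauerQ_succ hn (i + 1)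
  rw [C_sub, sub_mul, C_gegenbauerCoeff_mul_gegenbauerQ_succ hn,
    C_gegenbauerCoeff_mul_gegenbauerQ_succ hn, gegenbauerQ_succ_eq hn,
    gegenbauerQ_succ_eq hn] at hrec
  simp only [Nat.cast_add, Nat.cast_one, Nat.cast_ofNat, map_add, map_mul, map_natCast, map_ofNat,
    map_one] at hrec
  linear_combination -hrec

theorem derivative_ultraspherical {n : ℕ} (hn : 1 ≤ n) (i : ℕ) :
    X * derivative (ultraspherical n (i + 1)) - derivative (ultraspherical n i) =
        ((i : ℝ[X]) + 2) * ultraspherical n (i + 1) ∧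
      derivative (ultraspherical n (i + 1)) - X * derivative (ultraspherical n i) =
        ((n : ℝ[X]) + (i : ℝ[X]) - 1) * ultraspherical n i := by
  induction i with
  | zero =>
    have hone := two_mul_ultraspherical_one hn
    have hd := congr_arg derivative hone
    simp only [derivative_mul, derivative_sub, derivative_X_sq, derivative_one,
      derivative_ofNat, derivative_natCast, map_ofNat, zero_mul, zero_add, sub_zero] at hd
    rw [ultraspherical_zero hn, derivative_X]
    have hd' : derivative (ultraspherical n 1) = (n : ℝ[X]) * X :=
      mul_left_cancel₀ (two_ne_zero (α := ℝ[X])) (by linear_combination hd)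
    simp only [zero_add, Nat.cast_zero, hd']
    constructor
    · linear_combination -hone
    · ring
  | succ i ih =>
    obtain ⟨ha, hb⟩ := ih
    have hrec := ultraspherical_add_two hn i
    have hd := congr_arg derivative hrec
    simp only [derivative_mul, derivative_sub, derivative_add, derivative_X, derivative_one,
      derivative_ofNat, derivative_natCast, zero_mul, zero_add, add_zero, mul_zero, sub_zero,
      mul_one] at hd
    have hne : (i : ℝ[X]) + 3 ≠ 0 := by exact_mod_cast (Nat.succ_ne_zero (i + 2))
    have hb' : derivative (ultraspherical n (i + 2)) - X * derivative (ultraspherical n (i + 1)) =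
        ((n : ℝ[X]) + (i : ℝ[X])) * ultraspherical n (i + 1) :=
      mul_left_cancel₀ hne (by
        linear_combination hd + ((n : ℝ[X]) + (i : ℝ[X]) - 1) * ha)
    push_cast
    constructor
    · linear_combination X * hb' + X * ha - hb - hrec
    · linear_combination hb'

/-- Gegenbauer's differential equation, with `Q_{i+1}` as an eigenfunction for the eigenvalue
`-(i+1)(n+i-1)`. -/
theorem ultraspherical_eigen {n : ℕ} (hn : 1 ≤ n) (i : ℕ) :
    ((i : ℝ[X]) + 1) * ((n : ℝ[X]) + (i : ℝ[X]) - 1) * ultraspherical n i =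
      ((n : ℝ[X]) - 1) * X * derivative (ultraspherical n i) -
        (1 - X ^ 2) * derivative (derivative (ultraspherical n i)) := by
  cases i with
  | zero => simp [ultraspherical_zero hn]
  | succ i =>
    obtain ⟨ha, hb⟩ := derivative_ultraspherical hn i
    have hda := congr_arg derivative ha
    have hdb := congr_arg derivative hb
    simp only [derivative_mul, derivative_sub, derivative_add, derivative_X, derivative_one,
      derivative_ofNat, derivative_natCast, zero_mul, zero_add, add_zero, one_mul,
      sub_zero] at hda hdb
    push_cast
    linear_combination hdb - X * hda - ((n : ℝ[X]) + (i : ℝ[X])) * ha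

theorem apply_C_mul {R : Type*} [CommSemiring R] (φ : R[X] →ₗ[R] R) (c : R) (p : R[X]) :
    φ (C c * p) = c * φ p := by
  rw [C_mul', map_smul, smul_eq_mul]

/-- A linear functional on real polynomials with the moments of the distribution of a coordinate
of a uniformly random point on the unit sphere of `ℝ^n`. -/
structure IsGegenbauerFunctional (n : ℕ) (φ : ℝ[X] →ₗ[ℝ] ℝ) : Prop where
  one : φ 1 = 1
  comp_neg_X : ∀ p : ℝ[X], φ (p.comp (-X)) = φ p
  moment : ∀ j : ℕ, ((j : ℝ) + 1) * φ (X ^ j) = ((n : ℝ) + j) * φ (X ^ (j + 2))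

namespace IsGegenbauerFunctional

variable {n : ℕ} {φ : ℝ[X] →ₗ[ℝ] ℝ}

theorem apply_X (h : IsGegenbauerFunctional n φ) : φ X = 0 := by
  have hodd := h.comp_neg_X X
  rw [X_comp, map_neg] at hodd
  linarith

/-- Integration by parts against the weight `(1 - u²)^((n-3)/2)`. -/
theorem apply_mul_derivative (h : IsGegenbauerFunctional n φ) (f : ℝ[X]) :
    φ ((1 - X ^ 2) * derivative f) = ((n : ℝ) - 1) * φ (X * f) := by
  induction f using Polynomial.induction_on' with
  | add p q hp hq => rw [derivative_add, mul_add, mul_add, map_add, map_add, hp, hq, mul_add]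
  | monomial j a =>
    rw [← C_mul_X_pow_eq_monomial]
    cases j with
    | zero => simp [mul_comm X, apply_C_mul, h.apply_X]
    | succ j =>
      have hleft : (1 - X ^ 2) * derivative (C a * X ^ (j + 1)) =
          C (a * (j + 1)) * (X ^ j - X ^ (j + 2)) := by
        simp only [derivative_C_mul_X_pow, add_tsub_cancel_right, Nat.cast_add, Nat.cast_one]
        ring
      have hright : X * (C a * X ^ (j + 1)) = C a * X ^ (j + 2) := by ring
      rw [hleft, hright, apply_C_mul, apply_C_mul, map_sub]
      linear_combination a * h.moment j

theorem apply_gegenbauerQ_succ (h : IsGegenbauerFunctional n φ) (hn : 1 ≤ n) (i : ℕ) :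
    φ (gegenbauerQ n (i + 1)) = 0 := by
  rw [gegenbauerQ_succ_eq hn, apply_C_mul]
  suffices hS : φ (ultraspherical n i) = 0 by rw [hS, mul_zero]
  cases i with
  | zero => rw [ultraspherical_zero hn, h.apply_X]
  | succ i =>
    have heigen := congr_arg φ (ultraspherical_eigen hn (i + 1))
    rw [map_sub, h.apply_mul_derivative] at heigen
    have hl : (((i + 1 : ℕ) : ℝ[X]) + 1) * ((n : ℝ[X]) + ((i + 1 : ℕ) : ℝ[X]) - 1) =
      C (((i : ℝ) + 2) * (n + i)) := by
      simp only [map_mul, map_add, map_natCast, map_ofNat]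
      push_cast
      ring
    have hr : (n : ℝ[X]) - 1 = C ((n : ℝ) - 1) := by simp
    rw [hl, hr, mul_assoc, apply_C_mul, apply_C_mul, sub_self] at heigen
    exact (mul_eq_zero.1 heigen).resolve_left (by positivity)

theorem apply_X_pow_mul_gegenbauerQ (h : IsGegenbauerFunctional n φ) (hn : 1 ≤ n) {i j : ℕ}
    (hij : j < i) : φ (X ^ j * gegenbauerQ n i) = 0 := by
  obtain ⟨i, rfl⟩ := Nat.exists_eq_add_one_of_ne_zero (Nat.ne_zero_of_lt hij)
  induction j generalizing i with
  | zero => simpa using h.apply_gegenbauerQ_succ hn i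
  | succ j ih =>
    obtain ⟨i, rfl⟩ := Nat.exists_eq_add_one_of_ne_zero (show i ≠ 0 by omega)
    rw [pow_succ, mul_assoc, X_mul_gegenbauerQ_succ hn, mul_add, map_add, mul_left_comm,
      apply_C_mul, mul_left_comm, apply_C_mul, ih _ (by omega), ih _ (by omega), mul_zero, mul_zero,
      add_zero]

theorem apply_X_pow_mul_gegenbauerKernel (h : IsGegenbauerFunctional n φ) (hn : 1 ≤ n) {m j : ℕ}
    (hj : j ≤ m) : φ (X ^ j * gegenbauerKernel n m) = 1 := by
  induction j with
  | zero =>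
    rw [pow_zero, one_mul, gegenbauerKernel, Finset.sum_range_succ', map_add, map_sum,
      Finset.sum_eq_zero fun i _ => h.apply_gegenbauerQ_succ hn i, gegenbauerQ, h.one, zero_add]
  | succ j ih =>
    have hstep : φ (X ^ j * ((X - 1) * gegenbauerKernel n m)) = 0 := by
      rw [X_sub_one_mul_gegenbauerKernel hn, mul_sub, map_sub, mul_left_comm, apply_C_mul,
        mul_left_comm, apply_C_mul, h.apply_X_pow_mul_gegenbauerQ hn (by omega),
        h.apply_X_pow_mul_gegenbauerQ hn (by omega), mul_zero, mul_zero, sub_zero]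
    rw [← ih (by omega), ← sub_eq_zero, ← map_sub, ← hstep]
    congr 1
    ring

theorem apply_mul_gegenbauerKernel (h : IsGegenbauerFunctional n φ) (hn : 1 ≤ n) {m : ℕ}
    {p : ℝ[X]} (hp : p.natDegree ≤ m) : φ (p * gegenbauerKernel n m) = p.eval 1 := by
  rw [eval_eq_sum_range]
  conv_lhs => rw [p.as_sum_range_C_mul_X_pow, Finset.sum_mul, map_sum]
  refine Finset.sum_congr rfl fun j hj => ?_
  rw [mul_assoc, apply_C_mul, h.apply_X_pow_mul_gegenbauerKernel hn
    (by rw [Finset.mem_range] at hj; omega), one_pow]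

theorem apply_mul_gegenbauerSum (h : IsGegenbauerFunctional n φ) (hn : 1 ≤ n) {m : ℕ} {p : ℝ[X]}
    (hp : p.natDegree ≤ m) (hparity : p.comp (-X) = (-1) ^ m * p) :
    φ (p * gegenbauerSum n m) = p.eval 1 := by
  have hreflect : (-1) ^ m * (p * (gegenbauerKernel n m).comp (-X)) =
      (p * gegenbauerKernel n m).comp (-X) := by
    rw [mul_comp, hparity]
    ring
  have htwo : C 2 * (p * gegenbauerSum n m) =
      p * gegenbauerKernel n m + (p * gegenbauerKernel n m).comp (-X) := by
    rw [← hreflect, C_ofNat]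
    linear_combination p * two_mul_gegenbauerSum n m
  have hφ := congr_arg φ htwo
  rw [apply_C_mul, map_add, h.comp_neg_X, h.apply_mul_gegenbauerKernel hn hp] at hφ
  linarith

end IsGegenbauerFunctional

/-! ### Linear functionals on polynomials in several variables -/

/-- The linear form `x ↦ ⟪v, x⟫`. -/
noncomputable def linForm {n : ℕ} (v : EuclideanSpace ℝ (Fin n)) : MvPolynomial (Fin n) ℝ :=
  ∑ i, v i • MvPolynomial.X i

/-- The quadratic form `x ↦ ‖x‖ ^ 2`. -/
noncomputable def normSqForm (n : ℕ) : MvPolynomial (Fin n) ℝ :=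
  ∑ i, MvPolynomial.X i ^ 2

section Forms

variable {n : ℕ}

theorem eval_linForm (v x : EuclideanSpace ℝ (Fin n)) :
    MvPolynomial.eval (fun i => x i) (linForm v) = ⟪v, x⟫ := by
  simp [linForm, PiLp.inner_apply, MvPolynomial.smul_eval, mul_comm]

theorem eval_normSqForm (x : EuclideanSpace ℝ (Fin n)) :
    MvPolynomial.eval (fun i => x i) (normSqForm n) = ‖x‖ ^ 2 := by
  simp [normSqForm, EuclideanSpace.norm_sq_eq]

theorem isHomogeneous_linForm (v : EuclideanSpace ℝ (Fin n)) : (linForm v).IsHomogeneous 1 :=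
  MvPolynomial.IsHomogeneous.sum _ _ _ fun i _ => by
    simpa [MvPolynomial.smul_eq_C_mul] using MvPolynomial.isHomogeneous_C_mul_X (v i) i

theorem isHomogeneous_linForm_pow (v : EuclideanSpace ℝ (Fin n)) (d : ℕ) :
    (linForm v ^ d).IsHomogeneous d := by
  simpa using (isHomogeneous_linForm v).pow d

theorem isHomogeneous_normSqForm_pow (n d : ℕ) : (normSqForm n ^ d).IsHomogeneous (2 * d) :=
  (MvPolynomial.IsHomogeneous.sum _ _ _ fun i _ => MvPolynomial.isHomogeneous_X_pow i 2).pow d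

theorem linForm_neg (v : EuclideanSpace ℝ (Fin n)) : linForm (-v) = -linForm v := by
  simp [linForm]

theorem linForm_add (v w : EuclideanSpace ℝ (Fin n)) :
    linForm (v + w) = linForm v + linForm w := by
  simp [linForm, add_smul, Finset.sum_add_distrib]

theorem linForm_smul (c : ℝ) (v : EuclideanSpace ℝ (Fin n)) : linForm (c • v) = c • linForm v := by
  simp [linForm, Finset.smul_sum, smul_smul]

theorem linForm_single (i : Fin n) :
    linForm (EuclideanSpace.single i (1 : ℝ)) = MvPolynomial.X i := by
  simp [linForm]

theorem linForm_pow_eq_sum (v : EuclideanSpace ℝ (Fin n)) (d : ℕ) :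
    linForm v ^ d = ∑ s ∈ Finset.univ.finsuppAntidiag d,
      MvPolynomial.monomial s ((s.multinomial : ℝ) * ∏ i, v i ^ s i) := by
  ext s
  rw [linForm, MvPolynomial.coeff_linearCombination_X_pow_of_fintype, MvPolynomial.coeff_sum]
  simp [MvPolynomial.coeff_monomial, Finset.mem_finsuppAntidiag, Finsupp.prod_fintype,
    Finsupp.sum_fintype]

/-- The polynomial `v ↦ Λ (⟪v, ·⟫ ^ d)`. -/
noncomputable def powerTransform (Λ : MvPolynomial (Fin n) ℝ →ₗ[ℝ] ℝ) (d : ℕ) :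
    MvPolynomial (Fin n) ℝ :=
  ∑ s ∈ Finset.univ.finsuppAntidiag d,
    MvPolynomial.monomial s ((s.multinomial : ℝ) * Λ (MvPolynomial.monomial s 1))

theorem apply_monomial (Λ : MvPolynomial (Fin n) ℝ →ₗ[ℝ] ℝ) (s : Fin n →₀ ℕ) (c : ℝ) :
    Λ (MvPolynomial.monomial s c) = c * Λ (MvPolynomial.monomial s 1) := by
  rw [← smul_eq_mul, ← map_smul, MvPolynomial.smul_monomial, smul_eq_mul, mul_one]

theorem eval_powerTransform (Λ : MvPolynomial (Fin n) ℝ →ₗ[ℝ] ℝ) (d : ℕ)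
    (v : EuclideanSpace ℝ (Fin n)) :
    MvPolynomial.eval (fun i => v i) (powerTransform Λ d) = Λ (linForm v ^ d) := by
  rw [linForm_pow_eq_sum, powerTransform, map_sum, map_sum]
  refine Finset.sum_congr rfl fun s _ => ?_
  rw [MvPolynomial.eval_monomial, Finsupp.prod_fintype _ _ (by simp), apply_monomial Λ s (_ * _)]
  ring

theorem coeff_powerTransform (Λ : MvPolynomial (Fin n) ℝ →ₗ[ℝ] ℝ) (s : Fin n →₀ ℕ) :
    MvPolynomial.coeff s (powerTransform Λ s.degree) =
      s.multinomial * Λ (MvPolynomial.monomial s 1) := by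
  simp [powerTransform, MvPolynomial.coeff_sum, MvPolynomial.coeff_monomial,
    Finset.mem_finsuppAntidiag, Finsupp.degree_eq_sum]

theorem apply_eq_zero_of_linForm_pow (Λ : MvPolynomial (Fin n) ℝ →ₗ[ℝ] ℝ) {d : ℕ}
    (h : ∀ v : EuclideanSpace ℝ (Fin n), Λ (linForm v ^ d) = 0) {f : MvPolynomial (Fin n) ℝ}
    (hf : f.IsHomogeneous d) : Λ f = 0 := by
  have htransform : powerTransform Λ d = 0 := MvPolynomial.funext fun v => by
    rw [map_zero, ← h (WithLp.toLp 2 v), ← eval_powerTransform]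
  rw [f.as_sum, map_sum]
  refine Finset.sum_eq_zero fun s hs => ?_
  have hdegree : s.degree = d := by
    rw [Finsupp.degree_eq_weight_one]
    exact hf (MvPolynomial.mem_support_iff.1 hs)
  have hmonomial : Λ (MvPolynomial.monomial s 1) = 0 := by
    have hcoeff := coeff_powerTransform Λ s
    rw [hdegree, htransform, MvPolynomial.coeff_zero, zero_eq_mul, Nat.cast_eq_zero,
      Finsupp.multinomial_eq] at hcoeff
    exact hcoeff.resolve_left (Nat.multinomial_pos _ _).ne'
  rw [apply_monomial, hmonomial, mul_zero]

/-- Normalized linear functionals on polynomials which only depend on the restriction to the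
unit sphere and which vanish on odd powers of linear forms. -/
structure IsSphereAverage (Λ : MvPolynomial (Fin n) ℝ →ₗ[ℝ] ℝ) : Prop where
  one : Λ 1 = 1
  mul_normSqForm : ∀ f, Λ (f * normSqForm n) = Λ f
  odd : ∀ v d, Odd d → Λ (linForm v ^ d) = 0

/-- The functional takes the same value on the `d`-th powers of linear forms of equal length. -/
def IsInvariantInDegree (Λ : MvPolynomial (Fin n) ℝ →ₗ[ℝ] ℝ) (d : ℕ) : Prop :=
  ∀ v w : EuclideanSpace ℝ (Fin n), ‖v‖ = ‖w‖ → Λ (linForm v ^ d) = Λ (linForm w ^ d)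

variable {Λ Λ₁ Λ₂ : MvPolynomial (Fin n) ℝ →ₗ[ℝ] ℝ}

theorem IsInvariantInDegree.apply_linForm_pow {d : ℕ} (h : IsInvariantInDegree Λ d)
    {u : EuclideanSpace ℝ (Fin n)} (hu : ‖u‖ = 1) (v : EuclideanSpace ℝ (Fin n)) :
    Λ (linForm v ^ d) = ‖v‖ ^ d * Λ (linForm u ^ d) := by
  rw [h v (‖v‖ • u) (by simp [norm_smul, hu]), linForm_smul, _root_.smul_pow, map_smul, smul_eq_mul]

theorem IsSphereAverage.mul_normSqForm_pow (h : IsSphereAverage Λ) (f : MvPolynomial (Fin n) ℝ)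
    (j : ℕ) : Λ (f * normSqForm n ^ j) = Λ f := by
  induction j with
  | zero => simp
  | succ j ih => rw [pow_succ, ← mul_assoc, h.mul_normSqForm, ih]

theorem IsSphereAverage.normSqForm_pow (h : IsSphereAverage Λ) (j : ℕ) :
    Λ (normSqForm n ^ j) = 1 := by
  rw [← one_mul (normSqForm n ^ j), h.mul_normSqForm_pow, h.one]

theorem IsSphereAverage.eq_of_isHomogeneous (h₁ : IsSphereAverage Λ₁) (h₂ : IsSphereAverage Λ₂)
    {u : EuclideanSpace ℝ (Fin n)} (hu : ‖u‖ = 1) {e : ℕ}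
    (hi₁ : IsInvariantInDegree Λ₁ (2 * e)) (hi₂ : IsInvariantInDegree Λ₂ (2 * e))
    {f : MvPolynomial (Fin n) ℝ} (hf : f.IsHomogeneous (2 * e)) : Λ₁ f = Λ₂ f := by
  set c₁ := Λ₁ (linForm u ^ (2 * e))
  set c₂ := Λ₂ (linForm u ^ (2 * e))
  have hprop {p : MvPolynomial (Fin n) ℝ} (hp : p.IsHomogeneous (2 * e)) :
      c₂ * Λ₁ p = c₁ * Λ₂ p := by
    refine sub_eq_zero.1 (apply_eq_zero_of_linForm_pow (c₂ • Λ₁ - c₁ • Λ₂) (fun v => ?_) hp)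
    change c₂ * Λ₁ _ - c₁ * Λ₂ _ = 0
    rw [hi₁.apply_linForm_pow hu v, hi₂.apply_linForm_pow hu v]
    ring
  have hc : c₂ = c₁ := by
    simpa only [h₁.normSqForm_pow, h₂.normSqForm_pow, mul_one]
      using hprop (isHomogeneous_normSqForm_pow n e)
  have hne : c₁ ≠ 0 := fun hzero => by
    have hkills := apply_eq_zero_of_linForm_pow Λ₁ (fun v => by
      rw [hi₁.apply_linForm_pow hu v]; exact mul_eq_zero_of_right _ hzero)
      (isHomogeneous_normSqForm_pow n e)
    exact one_ne_zero ((h₁.normSqForm_pow e).symm.trans hkills)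
  exact mul_left_cancel₀ hne (hc ▸ hprop hf)

theorem IsSphereAverage.eq_of_totalDegree_le (h₁ : IsSphereAverage Λ₁) (h₂ : IsSphereAverage Λ₂)
    {u : EuclideanSpace ℝ (Fin n)} (hu : ‖u‖ = 1) {e : ℕ}
    (hi₁ : IsInvariantInDegree Λ₁ (2 * e)) (hi₂ : IsInvariantInDegree Λ₂ (2 * e))
    {f : MvPolynomial (Fin n) ℝ} (hf : f.totalDegree ≤ 2 * e + 1) : Λ₁ f = Λ₂ f := by
  rw [← f.sum_homogeneousComponent, map_sum, map_sum]
  refine Finset.sum_congr rfl fun d hd => ?_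
  have hle : d ≤ 2 * e + 1 := by rw [Finset.mem_range] at hd; omega
  have hhom := MvPolynomial.homogeneousComponent_isHomogeneous d f
  rcases Nat.even_or_odd d with ⟨i, hi⟩ | hodd
  · rw [← h₁.mul_normSqForm_pow _ (e - i), ← h₂.mul_normSqForm_pow _ (e - i)]
    refine h₁.eq_of_isHomogeneous h₂ hu hi₁ hi₂ ?_
    convert hhom.mul (isHomogeneous_normSqForm_pow n (e - i)) using 1
    omega
  · rw [apply_eq_zero_of_linForm_pow Λ₁ (fun v => h₁.odd v d hodd) hhom,
      apply_eq_zero_of_linForm_pow Λ₂ (fun v => h₂.odd v d hodd) hhom]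

theorem coeff_two_of_sum_eq_mul_pow {m : ℕ} {a : ℕ → ℝ} {c : ℝ}
    (h : ∀ t : ℝ, ∑ i ∈ Finset.range (2 * m + 3), a i * t ^ i = c * (1 + t ^ 2) ^ (m + 1)) :
    a 2 = c * (m + 1) := by
  have hpoly : ∑ i ∈ Finset.range (2 * m + 3), C (a i) * X ^ i =
      C c * expand ℝ 2 ((1 + X) ^ (m + 1)) := Polynomial.funext fun t => by
    simpa [eval_finsetSum] using h t
  have hcoeff := congr_arg (coeff · (1 * 2)) hpoly
  simp only [coeff_C_mul, coeff_expand_mul two_pos, coeff_one_add_X_pow, finsetSum_coeff,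
    coeff_X_pow] at hcoeff
  simpa using hcoeff

/-- The value of an invariant functional on `(x_a + t x_b) ^ (2j + 2)` is a multiple of
`(1 + t²) ^ (j + 1)`; compare the coefficients of `t²`. -/
theorem IsInvariantInDegree.apply_X_pow_mul_X_sq {j : ℕ}
    (h : IsInvariantInDegree Λ (2 * j + 2)) {a b : Fin n} (hab : a ≠ b) :
    (2 * (j : ℝ) + 1) * Λ (MvPolynomial.X a ^ (2 * j) * MvPolynomial.X b ^ 2) =
      Λ (MvPolynomial.X a ^ (2 * j + 2)) := by
  set u := EuclideanSpace.single a (1 : ℝ)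
  have hu : ‖u‖ = 1 := by simp [u]
  set w : ℝ → EuclideanSpace ℝ (Fin n) := fun t => u + t • EuclideanSpace.single b (1 : ℝ)
  have hexpand (t : ℝ) : Λ (linForm (w t) ^ (2 * j + 2)) = ∑ i ∈ Finset.range (2 * j + 3),
      ((2 * j + 2).choose i * Λ (MvPolynomial.X a ^ (2 * j + 2 - i) * MvPolynomial.X b ^ i)) *
        t ^ i := by
    rw [linForm_add, linForm_smul, linForm_single, linForm_single, add_comm, add_pow, map_sum]
    refine Finset.sum_congr rfl fun i _ => ?_
    rw [_root_.smul_pow, ← nsmul_eq_mul', smul_mul_assoc, map_nsmul, map_smul, nsmul_eq_mul,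
      smul_eq_mul, mul_comm (MvPolynomial.X b ^ i)]
    ring
  have hnorm (t : ℝ) : ‖w t‖ ^ 2 = 1 + t ^ 2 := by
    have horth : ⟪u, t • EuclideanSpace.single b (1 : ℝ)⟫ = 0 := by
      simp [u, inner_smul_right, EuclideanSpace.inner_single_left, hab]
    have hpyth := norm_add_sq_real u (t • EuclideanSpace.single b (1 : ℝ))
    simpa [horth, hu, norm_smul] using hpyth
  have hcoeff := coeff_two_of_sum_eq_mul_pow (m := j) (c := Λ (linForm u ^ (2 * j + 2))) fun t => by
    rw [← hexpand, h.apply_linForm_pow hu, ← hnorm, ← pow_mul, mul_comm]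
    rfl
  rw [linForm_single, Nat.cast_choose_two, add_tsub_cancel_right] at hcoeff
  push_cast at hcoeff
  exact mul_left_cancel₀ (show (j : ℝ) + 1 ≠ 0 by positivity) (by linear_combination hcoeff)

theorem apply_aeval_linForm_eq (h : ∀ d, IsInvariantInDegree Λ d)
    {v w : EuclideanSpace ℝ (Fin n)} (hvw : ‖v‖ = ‖w‖) (p : ℝ[X]) :
    Λ (aeval (linForm v) p) = Λ (aeval (linForm w) p) := by
  simp only [aeval_eq_sum_range, map_sum, map_smul, h _ v w hvw]

theorem IsSphereAverage.moment (h : IsSphereAverage Λ) (hi : ∀ d, IsInvariantInDegree Λ d)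
    {v : EuclideanSpace ℝ (Fin n)} (hv : ‖v‖ = 1) (j : ℕ) :
    ((j : ℝ) + 1) * Λ (linForm v ^ j) = ((n : ℝ) + j) * Λ (linForm v ^ (j + 2)) := by
  rcases Nat.even_or_odd' j with ⟨i, rfl | rfl⟩
  · have hn : 0 < n := Nat.pos_of_ne_zero <| by
      rintro rfl
      simp [Subsingleton.elim v 0] at hv
    set a : Fin n := ⟨0, hn⟩
    have hva : ‖v‖ = ‖EuclideanSpace.single a (1 : ℝ)‖ := by simp [hv]
    have hmixed (b : Fin n) (hb : b ∈ Finset.univ.erase a) :=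
      (hi (2 * i + 2)).apply_X_pow_mul_X_sq (Finset.ne_of_mem_erase hb).symm
    rw [hi _ v _ hva, hi _ v _ hva, linForm_single,
      ← h.mul_normSqForm (MvPolynomial.X a ^ (2 * i)), normSqForm, Finset.mul_sum, map_sum,
      Finset.mul_sum, ← Finset.add_sum_erase _ _ (Finset.mem_univ a), ← pow_add]
    push_cast
    rw [Finset.sum_congr rfl hmixed, Finset.sum_const, Finset.card_erase_of_mem (Finset.mem_univ a),
      Finset.card_univ, Fintype.card_fin, nsmul_eq_mul, Nat.cast_pred hn]
    ring
  · have hodd := odd_two_mul_add_one i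
    rw [h.odd v _ hodd, h.odd v _ (hodd.add_even even_two), mul_zero, mul_zero]

theorem IsSphereAverage.isGegenbauerFunctional (h : IsSphereAverage Λ)
    (hi : ∀ d, IsInvariantInDegree Λ d) {v : EuclideanSpace ℝ (Fin n)} (hv : ‖v‖ = 1) :
    IsGegenbauerFunctional n (Λ ∘ₗ (aeval (linForm v)).toLinearMap) where
  one := by simp [h.one]
  comp_neg_X p := by
    have hneg : aeval (linForm v) (p.comp (-X)) = aeval (linForm (-v)) p := by
      rw [aeval_comp, map_neg, aeval_X, linForm_neg]
    simp only [LinearMap.comp_apply, AlgHom.toLinearMap_apply, hneg]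
    exact apply_aeval_linForm_eq hi (norm_neg v) p
  moment j := by simpa using h.moment hi hv j

end Forms

/-! ### The unit sphere -/

section InnerProductSpace

variable {E : Type*} [NormedAddCommGroup E] [InnerProductSpace ℝ E]

theorem inner_mem_Ioo {x y : E} (hx : ‖x‖ = 1) (hy : ‖y‖ = 1) (hne : x ≠ y) (hne' : x ≠ -y) :
    ⟪x, y⟫ ∈ Set.Ioo (-1 : ℝ) 1 := by
  have hlt := (inner_lt_one_iff_real_of_norm_eq_one hx hy).2 hne
  have hlt' := (inner_lt_one_iff_real_of_norm_eq_one hx ((norm_neg y).trans hy)).2 hne'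
  rw [inner_neg_right] at hlt'
  exact ⟨neg_lt.1 hlt', hlt⟩

theorem exists_norm_eq_one_inner_eq (hE : 1 < Module.rank ℝ E) {y : E} (hy : ‖y‖ = 1) {u : ℝ}
    (hu : u ∈ Set.Icc (-1 : ℝ) 1) : ∃ v : E, ‖v‖ = 1 ∧ ⟪v, y⟫ = u := by
  have hcont : ContinuousOn (fun v : E => ⟪v, y⟫) (Metric.sphere 0 1) := by fun_prop
  have hivt := (isPreconnected_sphere hE (0 : E) 1).intermediate_value
    (a := -y) (b := y) (by simp [hy]) (by simp [hy]) hcont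
  simp only [inner_neg_left, real_inner_self_eq_norm_sq, hy, one_pow] at hivt
  obtain ⟨v, hv, hvu⟩ := hivt hu
  exact ⟨v, mem_sphere_zero_iff_norm.1 hv, hvu⟩

theorem exists_linearIsometryEquiv_apply_eq {v w : E} (h : ‖v‖ = ‖w‖) :
    ∃ R : E ≃ₗᵢ[ℝ] E, R v = w :=
  ⟨(ℝ ∙ (v - w))ᗮ.reflection, Submodule.reflection_sub h⟩

end InnerProductSpace

section Sphere

variable {n : ℕ}

/-- The action of a linear isometry on the unit sphere. -/
noncomputable def sphereMap (R : EuclideanSpace ℝ (Fin n) ≃ₗᵢ[ℝ] EuclideanSpace ℝ (Fin n))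
    (u : Metric.sphere (0 : EuclideanSpace ℝ (Fin n)) 1) :
    Metric.sphere (0 : EuclideanSpace ℝ (Fin n)) 1 :=
  ⟨R u, by simp⟩

variable (R : EuclideanSpace ℝ (Fin n) ≃ₗᵢ[ℝ] EuclideanSpace ℝ (Fin n))

theorem continuous_sphereMap : Continuous (sphereMap R) :=
  (R.continuous.comp continuous_subtype_val).subtype_mk _

theorem smul_image_preimage_sphereMap
    (s : Set (Metric.sphere (0 : EuclideanSpace ℝ (Fin n)) 1)) :
    (Set.Ioo (0 : ℝ) 1 • ((↑) '' (sphereMap R ⁻¹' s)) : Set (EuclideanSpace ℝ (Fin n))) =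
      R ⁻¹' (Set.Ioo (0 : ℝ) 1 • ((↑) '' s)) := by
  ext x
  simp only [Set.mem_smul, Set.mem_preimage, Set.mem_image]
  constructor
  · rintro ⟨t, ht, _, ⟨u, hu, rfl⟩, rfl⟩
    exact ⟨t, ht, R u, ⟨sphereMap R u, hu, rfl⟩, by simp⟩
  · rintro ⟨t, ht, _, ⟨u, hu, rfl⟩, h⟩
    have hu' : sphereMap R (sphereMap R.symm u) = u := Subtype.ext (by simp [sphereMap])
    exact ⟨t, ht, _, ⟨sphereMap R.symm u, by rwa [hu'], rfl⟩,
      R.injective (by simp [sphereMap, h])⟩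

theorem map_sphereMap_toSphere :
    (volume : Measure (EuclideanSpace ℝ (Fin n))).toSphere.map (sphereMap R) =
      (volume : Measure (EuclideanSpace ℝ (Fin n))).toSphere := by
  have hmeas := (continuous_sphereMap R).measurable
  ext s hs
  rw [Measure.map_apply hmeas hs, Measure.toSphere_apply' _ hs,
    Measure.toSphere_apply' _ (hmeas hs), smul_image_preimage_sphereMap,
    R.measurePreserving.measure_preimage_emb R.toHomeomorph.measurableEmbedding]

theorem map_sphereMap_sphereMeasure :
    (sphereMeasure n).map (sphereMap R) = sphereMeasure n := by
  rw [sphereMeasure, Measure.map_smul, map_sphereMap_toSphere]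

instance : IsFiniteMeasure (sphereMeasure n) where
  measure_univ_lt_top := (ENNReal.inv_mul_le_one _).trans_lt ENNReal.one_lt_top

theorem isProbabilityMeasure_sphereMeasure (hn : 1 ≤ n) :
    IsProbabilityMeasure (sphereMeasure n) := by
  have : Nonempty (Fin n) := ⟨⟨0, hn⟩⟩
  have hne := Measure.measure_univ_ne_zero.2
    (Measure.toSphere_ne_zero (volume : Measure (EuclideanSpace ℝ (Fin n))))
  exact ⟨ENNReal.inv_mul_cancel hne (measure_ne_top _ _)⟩

theorem continuous_eval_sphere (f : MvPolynomial (Fin n) ℝ) :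
    Continuous fun u : Metric.sphere (0 : EuclideanSpace ℝ (Fin n)) 1 =>
      MvPolynomial.eval (fun i => (u : EuclideanSpace ℝ (Fin n)) i) f :=
  (MvPolynomial.continuous_eval f).comp (continuous_pi fun i => by fun_prop)

theorem integrable_eval_sphere (f : MvPolynomial (Fin n) ℝ) :
    Integrable (fun u : Metric.sphere (0 : EuclideanSpace ℝ (Fin n)) 1 =>
      MvPolynomial.eval (fun i => (u : EuclideanSpace ℝ (Fin n)) i) f) (sphereMeasure n) :=
  (continuous_eval_sphere f).integrable_of_hasCompactSupport (HasCompactSupport.of_compactSpace _)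

/-- Integration of polynomials over the unit sphere. -/
noncomputable def sphereIntegral (n : ℕ) : MvPolynomial (Fin n) ℝ →ₗ[ℝ] ℝ where
  toFun f := ∫ u : Metric.sphere (0 : EuclideanSpace ℝ (Fin n)) 1,
    MvPolynomial.eval (fun i => (u : EuclideanSpace ℝ (Fin n)) i) f ∂(sphereMeasure n)
  map_add' f g := by
    simp only [map_add]
    exact integral_add (integrable_eval_sphere f) (integrable_eval_sphere g)
  map_smul' c f := by
    simp only [MvPolynomial.smul_eval, RingHom.id_apply, smul_eq_mul]
    exact integral_const_mul c _

theorem sphereIntegral_apply (f : MvPolynomial (Fin n) ℝ) :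
    sphereIntegral n f = ∫ u : Metric.sphere (0 : EuclideanSpace ℝ (Fin n)) 1,
      MvPolynomial.eval (fun i => (u : EuclideanSpace ℝ (Fin n)) i) f ∂(sphereMeasure n) := rfl

theorem isInvariantInDegree_sphereIntegral (d : ℕ) :
    IsInvariantInDegree (sphereIntegral n) d := by
  intro v w hvw
  obtain ⟨R, rfl⟩ := exists_linearIsometryEquiv_apply_eq hvw
  rw [sphereIntegral_apply, sphereIntegral_apply]
  conv_rhs => rw [← map_sphereMap_sphereMeasure R,
    integral_map (continuous_sphereMap R).aemeasurable
      (continuous_eval_sphere _).aestronglyMeasurable]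
  simp only [map_pow, eval_linForm, sphereMap, R.inner_map_map]

theorem isSphereAverage_sphereIntegral (hn : 1 ≤ n) : IsSphereAverage (sphereIntegral n) where
  one := by
    have := isProbabilityMeasure_sphereMeasure hn
    simp [sphereIntegral_apply]
  mul_normSqForm f := by simp [sphereIntegral_apply, eval_normSqForm]
  odd v d hd := by
    have hneg := isInvariantInDegree_sphereIntegral d v (-v) (norm_neg v).symm
    rw [linForm_neg, hd.neg_pow, map_neg] at hneg
    linarith

end Sphere

/-! ### Zonal forms -/

theorem eval_neg_of_isHomogeneous {σ R : Type*} [CommRing R] {f : MvPolynomial σ R} {e : ℕ}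
    (hf : f.IsHomogeneous e) (x : σ → R) :
    MvPolynomial.eval (-x) f = (-1) ^ e * MvPolynomial.eval x f := by
  rw [MvPolynomial.eval_eq, MvPolynomial.eval_eq, Finset.mul_sum]
  refine Finset.sum_congr rfl fun d hd => ?_
  have hdegree : ∑ i ∈ d.support, d i = e := by
    rw [← Finsupp.degree_apply, Finsupp.degree_eq_weight_one]
    exact hf (MvPolynomial.mem_support_iff.1 hd)
  simp only [Pi.neg_apply, neg_pow (x _), Finset.prod_mul_distrib, Finset.prod_pow_eq_pow_sum,
    hdegree]
  ring

theorem finrank_homogeneousSubmodule (K : Type*) [Field K] (n e : ℕ) :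
    Module.finrank K (MvPolynomial.homogeneousSubmodule (Fin n) K e) = (n + e - 1).choose e := by
  have hset : {d : Fin n →₀ ℕ | d.degree = e} =
      ((Finset.univ : Finset (Fin n)).finsuppAntidiag e : Set (Fin n →₀ ℕ)) := by
    ext d
    simp [Finset.mem_finsuppAntidiag, Finsupp.degree_eq_sum]
  rw [MvPolynomial.homogeneousSubmodule_eq_finsupp_supported, hset,
    (AddMonoidAlgebra.supportedEquivFinsupp (R := K) (S := K) _).finrank_eq,
    Module.finrank_finsupp_self, ← Nat.card_eq_fintype_card, Nat.card_coe_set_eq,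
    Set.ncard_coe_finset, Finset.card_finsuppAntidiag_nat_eq_choose,
    Finset.card_univ, Fintype.card_fin]

section Zonal

variable {n : ℕ}

theorem eval_aeval_linForm (v x : EuclideanSpace ℝ (Fin n)) (p : ℝ[X]) :
    MvPolynomial.eval (fun i => x i) (aeval (linForm v) p) = p.eval ⟪v, x⟫ := by
  simp only [aeval_eq_sum_range, eval_eq_sum_range, map_sum, MvPolynomial.smul_eval, map_pow,
    eval_linForm]

theorem totalDegree_aeval_linForm_le (v : EuclideanSpace ℝ (Fin n)) (p : ℝ[X]) :
    (aeval (linForm v) p).totalDegree ≤ p.natDegree := by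
  rw [aeval_eq_sum_range]
  refine MvPolynomial.totalDegree_finsetSum_le fun j hj => ?_
  exact (MvPolynomial.totalDegree_smul_le _ _).trans
    ((isHomogeneous_linForm_pow v j).totalDegree_le.trans (Finset.mem_range_succ_iff.1 hj))

/-- The homogenization to degree `e` of the zonal function `x ↦ g ⟪y, x⟫` by powers of the
quadratic form `‖x‖ ^ 2`. It is meant for polynomials `g` of degree at most `e` which have the
parity of `e`; for the others the exponents `(e - j) / 2` are rounded. -/
noncomputable def zonalForm (e : ℕ) (g : ℝ[X]) (y : EuclideanSpace ℝ (Fin n)) :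
    MvPolynomial (Fin n) ℝ :=
  ∑ j ∈ Finset.range (e + 1), g.coeff j • (linForm y ^ j * normSqForm n ^ ((e - j) / 2))

theorem isHomogeneous_zonalForm {e : ℕ} {g : ℝ[X]} (hparity : g.comp (-X) = (-1) ^ e * g)
    (y : EuclideanSpace ℝ (Fin n)) : (zonalForm e g y).IsHomogeneous e := by
  refine MvPolynomial.IsHomogeneous.sum _ _ _ fun j hj => ?_
  have hle := Finset.mem_range_succ_iff.1 hj
  rcases Nat.even_or_odd (e - j) with heven | hodd
  · have hdegree : j + 2 * ((e - j) / 2) = e := by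
      have := Nat.two_mul_div_two_of_even heven
      omega
    have hform := (isHomogeneous_linForm_pow y j).mul
      (isHomogeneous_normSqForm_pow n ((e - j) / 2))
    rw [hdegree] at hform
    exact (MvPolynomial.homogeneousSubmodule (Fin n) ℝ e).smul_mem _ hform
  · have hsign : (-1 : ℝ) ^ e = -(-1) ^ j := by
      rw [← Nat.add_sub_of_le hle, pow_add, hodd.neg_one_pow, mul_neg_one]
    have hreflect : g.coeff j * (-1) ^ j = (-1) ^ e * g.coeff j := by
      rw [← comp_C_mul_X_coeff, ← coeff_C_mul, C_neg, C_1, neg_one_mul, hparity, C_pow, C_neg, C_1]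
    have hcoeff : g.coeff j = 0 := by
      have hne : (-1 : ℝ) ^ j ≠ 0 := by simp
      exact (mul_eq_zero.1 (by rw [hsign] at hreflect; linarith)).resolve_right hne
    rw [hcoeff, zero_smul]
    exact MvPolynomial.isHomogeneous_zero _ _ _

theorem eval_zonalForm {e : ℕ} {g : ℝ[X]} (hdeg : g.natDegree ≤ e)
    (y : EuclideanSpace ℝ (Fin n)) {x : EuclideanSpace ℝ (Fin n)} (hx : ‖x‖ = 1) :
    MvPolynomial.eval (fun i => x i) (zonalForm e g y) = g.eval ⟪y, x⟫ := by
  rw [eval_eq_sum_range' (Nat.lt_succ_of_le hdeg), zonalForm, map_sum]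
  simp [MvPolynomial.smul_eval, eval_linForm, eval_normSqForm, hx]

instance (e : ℕ) : Module.Finite ℝ (MvPolynomial.homogeneousSubmodule (Fin n) ℝ e) :=
  Module.Finite.iff_fg.2 (MvPolynomial.homogeneousSubmodule_fg (Fin n) ℝ e)

/-- `g` is an interpolation kernel of degree `e` on `Y`: the function `x ↦ g ⟪y, x⟫` is the
restriction to the sphere of a form of degree `e`, and on `Y` it is the indicator of `y`. -/
structure IsInterpolationKernel (Y : Finset (EuclideanSpace ℝ (Fin n))) (e : ℕ) (g : ℝ[X]) :
    Prop where
  norm_eq_one : ∀ y ∈ Y, ‖y‖ = 1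
  natDegree_le : g.natDegree ≤ e
  comp_neg_X : g.comp (-X) = (-1) ^ e * g
  eval_one : g.eval 1 = 1
  eval_inner : ∀ x ∈ Y, ∀ y ∈ Y, x ≠ y → g.eval ⟪x, y⟫ = 0

namespace IsInterpolationKernel

variable {Y : Finset (EuclideanSpace ℝ (Fin n))} {e : ℕ} {g : ℝ[X]}

/-- The zonal form of `y` as an element of the space of forms of degree `e`. -/
noncomputable def form (h : IsInterpolationKernel Y e g) (y : Y) :
    MvPolynomial.homogeneousSubmodule (Fin n) ℝ e :=
  ⟨zonalForm e g y.1, isHomogeneous_zonalForm h.comp_neg_X y.1⟩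

theorem eval_form (h : IsInterpolationKernel Y e g) (y z : Y) :
    MvPolynomial.eval (fun i => (z : EuclideanSpace ℝ (Fin n)) i) (h.form y).1 =
      if y = z then 1 else 0 := by
  rw [form, eval_zonalForm h.natDegree_le _ (h.norm_eq_one z z.2)]
  split_ifs with hyz
  · rw [hyz, real_inner_self_eq_norm_sq, h.norm_eq_one z z.2, one_pow, h.eval_one]
  · exact h.eval_inner y y.2 z z.2 fun heq => hyz (Subtype.ext heq)

theorem eval_sum_form (h : IsInterpolationKernel Y e g) (c : Y → ℝ) (z : Y) :
    MvPolynomial.eval (fun i => (z : EuclideanSpace ℝ (Fin n)) i) (∑ y, c y • h.form y).1 =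
      c z := by
  simp [MvPolynomial.smul_eval, h.eval_form]

theorem linearIndependent_form (h : IsInterpolationKernel Y e g) :
    LinearIndependent ℝ h.form :=
  Fintype.linearIndependent_iff.2 fun c hc z => by
    rw [← h.eval_sum_form c z, hc, Submodule.coe_zero, map_zero]

theorem card_le (h : IsInterpolationKernel Y e g) : Y.card ≤ (n + e - 1).choose e := by
  rw [← finrank_homogeneousSubmodule ℝ, ← Fintype.card_coe]
  exact h.linearIndependent_form.fintype_card_le_finrank

theorem eval_eq_sum (h : IsInterpolationKernel Y e g) (hcard : Y.card = (n + e - 1).choose e)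
    {p : MvPolynomial (Fin n) ℝ} (hp : p.IsHomogeneous e) {x : EuclideanSpace ℝ (Fin n)}
    (hx : ‖x‖ = 1) :
    MvPolynomial.eval (fun i => x i) p =
      ∑ y ∈ Y, MvPolynomial.eval (fun i => y i) p * g.eval ⟪y, x⟫ := by
  have hspan := h.linearIndependent_form.span_eq_top_of_card_eq_finrank' (by
    rw [finrank_homogeneousSubmodule, Fintype.card_coe, hcard])
  obtain ⟨c, hc⟩ := (Submodule.mem_span_range_iff_exists_fun ℝ).1
    (hspan ▸ Submodule.mem_top : (⟨p, hp⟩ : MvPolynomial.homogeneousSubmodule (Fin n) ℝ e) ∈ _)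
  have hp_eq : p = (∑ y, c y • h.form y).1 := congr_arg Subtype.val hc.symm
  have hcoeff (y : Y) : c y = MvPolynomial.eval (fun i => (y : EuclideanSpace ℝ (Fin n)) i) p := by
    rw [hp_eq, h.eval_sum_form]
  conv_lhs => rw [hp_eq]
  rw [← Finset.sum_coe_sort Y]
  simp [MvPolynomial.smul_eval, form, eval_zonalForm h.natDegree_le _ hx, hcoeff]

end IsInterpolationKernel

end Zonal

/-! ### Antipodal codes -/

/-- The polynomial with simple zeros at the elements of `S` and value `1` at `1`. -/
noncomputable def normalizedNodal (S : Finset ℝ) : ℝ[X] :=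
  ∏ α ∈ S, C (1 / (1 - α)) * (X - C α)

theorem natDegree_normalizedNodal_le (S : Finset ℝ) : (normalizedNodal S).natDegree ≤ S.card := by
  refine (natDegree_prod_le _ _).trans ?_
  rw [Finset.card_eq_sum_ones]
  exact Finset.sum_le_sum fun α _ => (natDegree_C_mul_le _ _).trans (natDegree_X_sub_C_le α)

theorem eval_one_normalizedNodal {S : Finset ℝ} (hS : (1 : ℝ) ∉ S) :
    (normalizedNodal S).eval 1 = 1 := by
  rw [normalizedNodal, eval_prod]
  refine Finset.prod_eq_one fun α hα => ?_
  have hne : 1 - α ≠ 0 := sub_ne_zero.2 fun h => hS (h ▸ hα)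
  simp [hne]

theorem eval_normalizedNodal_eq_zero {S : Finset ℝ} {u : ℝ} (hu : u ∈ S) :
    (normalizedNodal S).eval u = 0 := by
  rw [normalizedNodal, eval_prod]
  exact Finset.prod_eq_zero hu (by simp)

theorem normalizedNodal_comp_neg_X {S : Finset ℝ} (hS : ∀ α ∈ S, -α ∈ S) :
    (normalizedNodal S).comp (-X) = (-1) ^ S.card * normalizedNodal S := by
  simp only [normalizedNodal, Finset.prod_mul_distrib, mul_comp, prod_comp, C_comp, sub_comp,
    X_comp]
  rw [mul_left_comm, ← Finset.prod_const, ← Finset.prod_mul_distrib (f := fun _ => (-1 : ℝ[X]))]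
  congr 1
  refine Finset.prod_nbij' (fun α => -α) (fun α => -α) hS hS (by simp) (by simp) fun α _ => ?_
  rw [C_neg]
  ring

theorem aeval_normalizedNodal_eq_zero_iff {S : Finset ℝ} (hS : (1 : ℝ) ∉ S) {z : ℂ} :
    aeval z (normalizedNodal S) = 0 ↔ ∃ α ∈ S, z = α := by
  rw [normalizedNodal, map_prod, Finset.prod_eq_zero_iff]
  refine exists_congr fun α => and_congr_right fun hα => ?_
  have hne : 1 / (1 - α) ≠ 0 := one_div_ne_zero (sub_ne_zero.2 fun h => hS (h ▸ hα))
  rw [map_mul, aeval_C, mul_eq_zero, or_iff_right ((_root_.map_ne_zero _).2 hne), map_sub, aeval_X,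
    aeval_C, sub_eq_zero]
  rfl

section Codes

variable {n : ℕ}

theorem exists_disjoint_neg_union_neg_eq {X : Finset (EuclideanSpace ℝ (Fin n))}
    (hneg : ∀ x ∈ X, -x ∈ X) (hzero : 0 ∉ X) : ∃ Y, Disjoint Y (-Y) ∧ Y ∪ -Y = X := by
  classical
  refine ⟨{x ∈ X | 0 < toLex x.ofLp}, ?_, ?_⟩
  · refine Finset.disjoint_left.2 fun x hx hx' => ?_
    rw [Finset.mem_neg', Finset.mem_filter, WithLp.ofLp_neg, toLex_neg, neg_pos] at hx'
    exact lt_asymm hx'.2 (Finset.mem_filter.1 hx).2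
  · ext x
    have hmem : -x ∈ X ↔ x ∈ X := ⟨fun h => neg_neg x ▸ hneg _ h, hneg x⟩
    rw [Finset.mem_union, Finset.mem_neg', Finset.mem_filter, Finset.mem_filter, hmem,
      WithLp.ofLp_neg, toLex_neg, neg_pos, ← and_or_left, and_iff_left_iff_imp]
    intro hx
    refine lt_or_gt_of_ne fun h => hzero ?_
    rwa [show x = 0 from WithLp.ofLp_injective 2 (toLex.injective h.symm)] at hx

/-- Finite antipodal subsets of the unit sphere. -/
structure IsAntipodalCode (X : Finset (EuclideanSpace ℝ (Fin n))) : Prop where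
  norm_eq_one : ∀ x ∈ X, ‖x‖ = 1
  neg_mem : ∀ x ∈ X, -x ∈ X

open scoped Classical in
/-- The inner products of the pairs of distinct, non-antipodal points. -/
noncomputable def cosineSet (X : Finset (EuclideanSpace ℝ (Fin n))) : Finset ℝ :=
  {p ∈ X ×ˢ X | p.1 ≠ p.2 ∧ p.1 ≠ -p.2}.image fun p => ⟪p.1, p.2⟫

theorem mem_cosineSet {X : Finset (EuclideanSpace ℝ (Fin n))} {a : ℝ} :
    a ∈ cosineSet X ↔ ∃ x ∈ X, ∃ y ∈ X, x ≠ y ∧ x ≠ -y ∧ ⟪x, y⟫ = a := by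
  simp only [cosineSet, Finset.mem_image, Finset.mem_filter, Finset.mem_product, Prod.exists]
  grind

namespace IsAntipodalCode

variable {X : Finset (EuclideanSpace ℝ (Fin n))}

theorem cosineSet_subset_Ioo (h : IsAntipodalCode X) : ↑(cosineSet X) ⊆ Set.Ioo (-1 : ℝ) 1 := by
  intro a ha
  obtain ⟨x, hx, y, hy, hne, hne', rfl⟩ := mem_cosineSet.1 ha
  exact inner_mem_Ioo (h.norm_eq_one x hx) (h.norm_eq_one y hy) hne hne'

theorem one_notMem_cosineSet (h : IsAntipodalCode X) : (1 : ℝ) ∉ cosineSet X := fun hone =>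
  (h.cosineSet_subset_Ioo hone).2.false

theorem neg_one_notMem_cosineSet (h : IsAntipodalCode X) : (-1 : ℝ) ∉ cosineSet X := fun hone =>
  (h.cosineSet_subset_Ioo hone).1.false

theorem neg_mem_cosineSet (h : IsAntipodalCode X) {a : ℝ} (ha : a ∈ cosineSet X) :
    -a ∈ cosineSet X := by
  obtain ⟨x, hx, y, hy, hne, hne', rfl⟩ := mem_cosineSet.1 ha
  exact mem_cosineSet.2 ⟨x, hx, -y, h.neg_mem y hy, hne', by rwa [neg_neg], inner_neg_right x y⟩

theorem sum_neg (h : IsAntipodalCode X) (f : EuclideanSpace ℝ (Fin n) → ℝ) :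
    ∑ x ∈ X, f (-x) = ∑ x ∈ X, f x :=
  Finset.sum_nbij' (fun x => -x) (fun x => -x) h.neg_mem h.neg_mem (by simp) (by simp) (by simp)

theorem exists_half (h : IsAntipodalCode X) :
    ∃ Y, Disjoint Y (-Y) ∧ Y ∪ -Y = X ∧
      IsInterpolationKernel Y (cosineSet X).card (normalizedNodal (cosineSet X)) := by
  obtain ⟨Y, hdisj, hunion⟩ := exists_disjoint_neg_union_neg_eq h.neg_mem fun hzero => by
    simpa using h.norm_eq_one 0 hzero
  have hsub : Y ⊆ X := hunion ▸ Finset.subset_union_left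
  refine ⟨Y, hdisj, hunion, fun y hy => h.norm_eq_one y (hsub hy), natDegree_normalizedNodal_le _,
    normalizedNodal_comp_neg_X fun a => h.neg_mem_cosineSet,
    eval_one_normalizedNodal h.one_notMem_cosineSet, fun x hx y hy hne =>
      eval_normalizedNodal_eq_zero (mem_cosineSet.2 ⟨x, hsub hx, y, hsub hy, hne, ?_, rfl⟩)⟩
  rintro rfl
  exact Finset.disjoint_left.1 hdisj hy (Finset.mem_neg'.2 hx)

theorem card_le (h : IsAntipodalCode X) :
    X.card ≤ 2 * (n + (cosineSet X).card - 1).choose (cosineSet X).card := by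
  obtain ⟨Y, hdisj, hunion, hkernel⟩ := h.exists_half
  rw [← hunion, Finset.card_union_of_disjoint hdisj, Finset.card_neg, ← two_mul, hunion]
  exact Nat.mul_le_mul_left 2 hkernel.card_le

theorem innerProductSet_eq (h : IsAntipodalCode X) (hX : X.Nonempty) :
    innerProductSet (X : Set (EuclideanSpace ℝ (Fin n))) = {-1} ∪ (cosineSet X : Set ℝ) := by
  ext a
  constructor
  · rintro ⟨x, hx, y, hy, hne, rfl⟩
    by_cases hantipodal : x = -y
    · left
      simp [hantipodal, h.norm_eq_one y hy]
    · exact Or.inr (mem_cosineSet.2 ⟨x, hx, y, hy, hne, hantipodal, rfl⟩)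
  · rintro (rfl | ha)
    · obtain ⟨x, hx⟩ := hX
      have hinner : ⟪x, -x⟫ = (-1 : ℝ) := by simp [h.norm_eq_one x hx]
      refine ⟨x, hx, -x, h.neg_mem x hx, fun hself => ?_, hinner.symm⟩
      rw [← hself, real_inner_self_eq_norm_sq] at hinner
      linarith [sq_nonneg ‖x‖]
    · obtain ⟨x, hx, y, hy, hne, -, rfl⟩ := mem_cosineSet.1 ha
      exact ⟨x, hx, y, hy, hne, rfl⟩

theorem annihilator_eq (h : IsAntipodalCode X) (hX : X.Nonempty) :
    annihilator (X : Set (EuclideanSpace ℝ (Fin n))) =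
      C (1 / 2) * (1 + Polynomial.X) * normalizedNodal (cosineSet X) := by
  classical
  have hset : {-1} ∪ (cosineSet X : Set ℝ) = (insert (-1) (cosineSet X) : Finset ℝ) := by
    rw [Finset.coe_insert, Set.singleton_union]
  rw [annihilator, h.innerProductSet_eq hX, hset, finprod_mem_coe_finset,
    Finset.prod_insert h.neg_one_notMem_cosineSet, normalizedNodal]
  congr 1
  rw [sub_neg_eq_add, one_add_one_eq_two, C_neg, sub_neg_eq_add, C_1, add_comm]

end IsAntipodalCode

theorem strictMono_choose_add_sub_one (hn : 2 ≤ n) :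
    StrictMono fun e => (n + e - 1).choose e := by
  obtain ⟨m, rfl⟩ := Nat.exists_eq_add_of_le' hn
  refine strictMono_nat_of_lt_succ fun e => ?_
  simp only [← Nat.multichoose_eq]
  rw [show m + 2 = m + 1 + 1 from rfl, Nat.multichoose_succ_succ, Nat.multichoose_eq (m + 1)]
  have := Nat.choose_pos (show e + 1 ≤ m + 1 + (e + 1) - 1 by omega)
  omega

theorem IsAntipodalCode.cosineSet_eq_of_subset {X : Finset (EuclideanSpace ℝ (Fin n))}
    (h : IsAntipodalCode X) (hn : 2 ≤ n) {S : Finset ℝ} (hsub : cosineSet X ⊆ S)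
    (hcard : X.card = 2 * (n + S.card - 1).choose S.card) : cosineSet X = S := by
  refine Finset.eq_of_subset_of_card_le hsub ((strictMono_choose_add_sub_one hn).le_iff_le.1 ?_)
  have := h.card_le
  omega

/-- The average over a finite set. -/
noncomputable def codeAverage (X : Finset (EuclideanSpace ℝ (Fin n))) :
    MvPolynomial (Fin n) ℝ →ₗ[ℝ] ℝ where
  toFun f := (1 / (X.card : ℝ)) * ∑ x ∈ X, MvPolynomial.eval (fun i => x i) f
  map_add' f g := by simp [Finset.sum_add_distrib, mul_add]
  map_smul' c f := by
    simp only [MvPolynomial.smul_eval, ← Finset.mul_sum, RingHom.id_apply, smul_eq_mul]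
    ring

theorem codeAverage_apply (X : Finset (EuclideanSpace ℝ (Fin n))) (f : MvPolynomial (Fin n) ℝ) :
    codeAverage X f = (1 / (X.card : ℝ)) * ∑ x ∈ X, MvPolynomial.eval (fun i => x i) f := rfl

theorem IsAntipodalCode.isSphereAverage_codeAverage {X : Finset (EuclideanSpace ℝ (Fin n))}
    (h : IsAntipodalCode X) (hX : X.Nonempty) : IsSphereAverage (codeAverage X) where
  one := by simp [codeAverage_apply, hX.ne_empty]
  mul_normSqForm f := by
    rw [codeAverage_apply, codeAverage_apply]
    congr 1
    refine Finset.sum_congr rfl fun x hx => ?_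
    rw [map_mul, eval_normSqForm, h.norm_eq_one x hx, one_pow, mul_one]
  odd v d hd := by
    have hsum := h.sum_neg fun x => ⟪v, x⟫ ^ d
    simp only [inner_neg_right, hd.neg_pow, Finset.sum_neg_distrib] at hsum
    simp only [codeAverage_apply, map_pow, eval_linForm]
    rw [self_eq_neg.1 hsum.symm, mul_zero]

/-- Antipodal codes meeting the absolute bound `IsAntipodalCode.card_le`. -/
structure IsExtremalAntipodalCode (X : Finset (EuclideanSpace ℝ (Fin n))) : Prop
    extends IsAntipodalCode X where
  card_eq : X.card = 2 * (n + (cosineSet X).card - 1).choose (cosineSet X).card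

namespace IsExtremalAntipodalCode

variable {X : Finset (EuclideanSpace ℝ (Fin n))}

theorem nonempty (h : IsExtremalAntipodalCode X) : X.Nonempty := by
  by_contra hempty
  rw [Finset.not_nonempty_iff_eq_empty] at hempty
  simpa [hempty, cosineSet] using h.card_eq

theorem one_le_dim (h : IsExtremalAntipodalCode X) : 1 ≤ n := by
  obtain ⟨x, hx⟩ := h.nonempty
  refine Nat.one_le_iff_ne_zero.2 ?_
  rintro rfl
  simpa [Subsingleton.elim x 0] using h.norm_eq_one x hx

/-- The kernel reproduces forms of degree `#(cosineSet X)` from their values on the half of the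
code, hence, by parity, twice from their values on the code. -/
theorem two_mul_eval (h : IsExtremalAntipodalCode X) {p : MvPolynomial (Fin n) ℝ}
    (hp : p.IsHomogeneous (cosineSet X).card) {x : EuclideanSpace ℝ (Fin n)} (hx : ‖x‖ = 1) :
    2 * MvPolynomial.eval (fun i => x i) p = ∑ y ∈ X,
      MvPolynomial.eval (fun i => y i) p * (normalizedNodal (cosineSet X)).eval ⟪y, x⟫ := by
  obtain ⟨Y, hdisj, hunion, hkernel⟩ := h.exists_half
  have hcard : X.card = 2 * Y.card := by
    rw [← hunion, Finset.card_union_of_disjoint hdisj, Finset.card_neg, two_mul]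
  have hYcard := Nat.eq_of_mul_eq_mul_left two_pos (hcard.symm.trans h.card_eq)
  set e := (cosineSet X).card
  set g := normalizedNodal (cosineSet X)
  have heven (y : EuclideanSpace ℝ (Fin n)) :
      MvPolynomial.eval (fun i => (-y) i) p * g.eval ⟪-y, x⟫ =
        MvPolynomial.eval (fun i => y i) p * g.eval ⟪y, x⟫ := by
    have hform : MvPolynomial.eval (fun i => (-y) i) p =
        (-1) ^ e * MvPolynomial.eval (fun i => y i) p := eval_neg_of_isHomogeneous hp _
    have hsign : (-1 : ℝ) ^ e * (-1) ^ e = 1 := by rw [← mul_pow, neg_one_mul, neg_neg, one_pow]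
    have hneg : g.eval (-⟪y, x⟫) = (-1) ^ e * g.eval ⟪y, x⟫ := by
      simpa using congr_arg (eval ⟪y, x⟫) hkernel.comp_neg_X
    rw [inner_neg_left, hneg, hform]
    linear_combination (MvPolynomial.eval (fun i => y i) p * g.eval ⟪y, x⟫) * hsign
  rw [hkernel.eval_eq_sum hYcard hp hx, ← hunion, Finset.sum_union hdisj, Finset.sum_neg_index,
    Finset.sum_congr rfl fun y _ => heven y, two_mul]

/-- Apply the reproducing formula to `⟪v, ·⟫ ^ e` at the points `R⁻¹ x` and to `⟪R v, ·⟫ ^ e` at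
the points `R y`, for a rotation `R`; both lead to the same double sum. -/
theorem isInvariantInDegree_codeAverage (h : IsExtremalAntipodalCode X) :
    IsInvariantInDegree (codeAverage X) (2 * (cosineSet X).card) := by
  intro v w hvw
  obtain ⟨R, rfl⟩ := exists_linearIsometryEquiv_apply_eq hvw
  set e := (cosineSet X).card
  set g := normalizedNodal (cosineSet X)
  have hreproduce (u : EuclideanSpace ℝ (Fin n)) {x : EuclideanSpace ℝ (Fin n)} (hx : ‖x‖ = 1) :
      2 * ⟪u, x⟫ ^ e = ∑ y ∈ X, ⟪u, y⟫ ^ e * g.eval ⟪y, x⟫ := by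
    simpa only [map_pow, eval_linForm] using h.two_mul_eval (isHomogeneous_linForm_pow u e) hx
  have hadjoint (u x : EuclideanSpace ℝ (Fin n)) : ⟪u, R.symm x⟫ = ⟪R u, x⟫ := by
    rw [← R.inner_map_map, R.apply_symm_apply]
  have hleft : ∑ x ∈ X, ⟪R v, x⟫ ^ e * (2 * ⟪R v, x⟫ ^ e) =
      ∑ x ∈ X, ∑ y ∈ X, ⟪R v, x⟫ ^ e * (⟪v, y⟫ ^ e * g.eval ⟪R y, x⟫) := by
    refine Finset.sum_congr rfl fun x hx => ?_
    rw [← hadjoint v x, hreproduce v ((R.symm.norm_map x).trans (h.norm_eq_one x hx)),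
      Finset.mul_sum]
    simp only [hadjoint]
  have hright : ∑ y ∈ X, ⟪v, y⟫ ^ e * (2 * ⟪v, y⟫ ^ e) =
      ∑ y ∈ X, ∑ x ∈ X, ⟪R v, x⟫ ^ e * (⟪v, y⟫ ^ e * g.eval ⟪R y, x⟫) := by
    refine Finset.sum_congr rfl fun y hy => ?_
    rw [← R.inner_map_map v y, hreproduce (R v) ((R.norm_map y).trans (h.norm_eq_one y hy)),
      Finset.mul_sum]
    refine Finset.sum_congr rfl fun x _ => ?_
    rw [real_inner_comm x (R y)]
    ring
  have hsum := hright.trans (Finset.sum_comm.trans hleft.symm)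
  simp only [mul_left_comm _ (2 : ℝ), ← pow_add, ← two_mul, ← Finset.mul_sum] at hsum
  simp only [codeAverage_apply, map_pow, eval_linForm, mul_left_cancel₀ two_ne_zero hsum]

theorem codeAverage_eq_sphereIntegral (h : IsExtremalAntipodalCode X)
    {f : MvPolynomial (Fin n) ℝ} (hf : f.totalDegree ≤ 2 * (cosineSet X).card + 1) :
    codeAverage X f = sphereIntegral n f := by
  obtain ⟨x, hx⟩ := h.nonempty
  exact (h.isSphereAverage_codeAverage h.nonempty).eq_of_totalDegree_le
    (isSphereAverage_sphereIntegral h.one_le_dim) (h.norm_eq_one x hx)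
    h.isInvariantInDegree_codeAverage (isInvariantInDegree_sphereIntegral _) hf

theorem card_ne_zero (h : IsExtremalAntipodalCode X) : (X.card : ℝ) ≠ 0 :=
  Nat.cast_ne_zero.2 (Finset.card_ne_zero.2 h.nonempty)

theorem cast_card_eq (h : IsExtremalAntipodalCode X) :
    (X.card : ℝ) = 2 * ((n + (cosineSet X).card - 1).choose (cosineSet X).card : ℝ) := by
  exact_mod_cast h.card_eq

theorem sphereIntegral_aeval_linForm (h : IsExtremalAntipodalCode X) {p : ℝ[X]}
    (hp : p.natDegree ≤ 2 * (cosineSet X).card + 1) (v : EuclideanSpace ℝ (Fin n)) :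
    sphereIntegral n (aeval (linForm v) p) = (1 / (X.card : ℝ)) * ∑ x ∈ X, p.eval ⟪v, x⟫ := by
  rw [← h.codeAverage_eq_sphereIntegral ((totalDegree_aeval_linForm_le v p).trans hp),
    codeAverage_apply]
  simp only [eval_aeval_linForm]

theorem sphereIntegral_aeval_mul_normalizedNodal (h : IsExtremalAntipodalCode X) {p : ℝ[X]}
    (hp : p.natDegree ≤ (cosineSet X).card)
    (hparity : p.comp (-Polynomial.X) = (-1) ^ (cosineSet X).card * p)
    {v : EuclideanSpace ℝ (Fin n)} (hv : ‖v‖ = 1) :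
    sphereIntegral n (aeval (linForm v)
      (p * (C ((n + (cosineSet X).card - 1).choose (cosineSet X).card : ℝ) *
        normalizedNodal (cosineSet X)))) = p.eval 1 := by
  have hdegree : (p * normalizedNodal (cosineSet X)).natDegree ≤ 2 * (cosineSet X).card + 1 :=
    (natDegree_mul_le_of_le hp (natDegree_normalizedNodal_le _)).trans (by omega)
  have hreproduce := h.two_mul_eval (isHomogeneous_zonalForm hparity v) hv
  rw [eval_zonalForm hp v hv, real_inner_self_eq_norm_sq, hv, one_pow] at hreproduce
  have hsum : ∑ x ∈ X, (p * normalizedNodal (cosineSet X)).eval ⟪v, x⟫ = 2 * p.eval 1 := by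
    rw [hreproduce]
    refine Finset.sum_congr rfl fun x hx => ?_
    rw [eval_zonalForm hp v (h.norm_eq_one x hx), eval_mul, real_inner_comm v x]
  have hcard := h.cast_card_eq
  have hne := h.card_ne_zero
  rw [mul_left_comm, map_mul, aeval_C, ← Algebra.smul_def, map_smul,
    h.sphereIntegral_aeval_linForm hdegree, hsum, smul_eq_mul]
  field_simp
  linear_combination -p.eval 1 * hcard

theorem eq_zero_of_sphereIntegral_sq_eq_zero (h : IsExtremalAntipodalCode X) (hn : 2 ≤ n)
    {p : ℝ[X]} (hp : p.natDegree ≤ (cosineSet X).card)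
    (hzero : ∀ v : EuclideanSpace ℝ (Fin n), ‖v‖ = 1 →
      sphereIntegral n (aeval (linForm v) (p * p)) = 0) : p = 0 := by
  obtain ⟨x, hx⟩ := h.nonempty
  have hrank : 1 < Module.rank ℝ (EuclideanSpace ℝ (Fin n)) := by
    rw [← Module.finrank_eq_rank, finrank_euclideanSpace_fin]
    exact_mod_cast hn
  refine eq_zero_of_infinite_isRoot p ((Set.Icc_infinite (by norm_num : (-1 : ℝ) < 1)).mono ?_)
  intro u hu
  obtain ⟨v, hv, rfl⟩ := exists_norm_eq_one_inner_eq hrank (h.norm_eq_one x hx) hu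
  have hsum := hzero v hv
  rw [h.sphereIntegral_aeval_linForm ((natDegree_mul_le_of_le hp hp).trans (by omega)),
    mul_eq_zero, or_iff_right (one_div_ne_zero h.card_ne_zero)] at hsum
  simp only [eval_mul] at hsum
  exact mul_self_eq_zero.1 ((Finset.sum_eq_zero_iff_of_nonneg fun y _ => mul_self_nonneg _).1
    hsum x hx)

/-- Both sides represent the evaluation at `1` among the polynomials of degree at most
`#(cosineSet X)` and of its parity, so their difference has vanishing square integral. -/
theorem C_mul_normalizedNodal_eq_gegenbauerSum (h : IsExtremalAntipodalCode X) (hn : 2 ≤ n) :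
    C ((n + (cosineSet X).card - 1).choose (cosineSet X).card : ℝ) *
      normalizedNodal (cosineSet X) = gegenbauerSum n (cosineSet X).card := by
  set D := C ((n + (cosineSet X).card - 1).choose (cosineSet X).card : ℝ) *
    normalizedNodal (cosineSet X) - gegenbauerSum n (cosineSet X).card with hD
  have hdegree : D.natDegree ≤ (cosineSet X).card :=
    (natDegree_sub_le _ _).trans (max_le
      ((natDegree_C_mul_le _ _).trans (natDegree_normalizedNodal_le _))
      (natDegree_gegenbauerSum_le _ _))
  have hparity : D.comp (-Polynomial.X) = (-1) ^ (cosineSet X).card * D := by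
    rw [hD, sub_comp, mul_comp, C_comp, gegenbauerSum_comp_neg_X,
      normalizedNodal_comp_neg_X fun _ => h.neg_mem_cosineSet]
    ring
  refine sub_eq_zero.1 (h.eq_zero_of_sphereIntegral_sq_eq_zero hn hdegree fun v hv => ?_)
  have hgegenbauer := ((isSphereAverage_sphereIntegral h.one_le_dim).isGegenbauerFunctional
    isInvariantInDegree_sphereIntegral hv).apply_mul_gegenbauerSum h.one_le_dim hdegree hparity
  rw [← hD, show D * D = D * (C _ * normalizedNodal (cosineSet X)) - D * gegenbauerSum n _ from
    mul_sub _ _ _, map_sub, map_sub, h.sphereIntegral_aeval_mul_normalizedNodal hdegree hparity hv]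
  exact sub_eq_zero.2 hgegenbauer.symm

theorem C_mul_annihilator_eq (h : IsExtremalAntipodalCode X) (hn : 2 ≤ n) :
    C (2 * ((n + (cosineSet X).card - 1).choose (cosineSet X).card : ℝ)) *
      annihilator (X : Set (EuclideanSpace ℝ (Fin n))) =
        (1 + Polynomial.X) * gegenbauerSum n (cosineSet X).card := by
  rw [h.annihilator_eq h.nonempty, ← h.C_mul_normalizedNodal_eq_gegenbauerSum hn, C_mul]
  have htwo : (C 2 * C (1 / 2) : ℝ[X]) = 1 := by rw [← C_mul]; norm_num
  linear_combination (C ((n + (cosineSet X).card - 1).choose (cosineSet X).card : ℝ) *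
    (1 + Polynomial.X) * normalizedNodal (cosineSet X)) * htwo

theorem aeval_gegenbauerSum_eq_zero_iff (h : IsExtremalAntipodalCode X) (hn : 2 ≤ n) {z : ℂ} :
    aeval z (gegenbauerSum n (cosineSet X).card) = 0 ↔ ∃ α ∈ cosineSet X, z = α := by
  have hne : ((n + (cosineSet X).card - 1).choose (cosineSet X).card : ℝ) ≠ 0 := fun hzero =>
    h.card_ne_zero (by rw [h.cast_card_eq, hzero, mul_zero])
  rw [← h.C_mul_normalizedNodal_eq_gegenbauerSum hn, map_mul, aeval_C, mul_eq_zero,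
    or_iff_right ((_root_.map_ne_zero _).2 hne),
    aeval_normalizedNodal_eq_zero_iff h.one_notMem_cosineSet]

theorem isTightSphericalDesign (h : IsExtremalAntipodalCode X) :
    IsTightSphericalDesign (2 * (cosineSet X).card + 1)
      (X : Set (EuclideanSpace ℝ (Fin n))) where
  left :=
    { finite := X.finite_toSet
      nonempty := h.nonempty
      subset_sphere := fun x hx => mem_sphere_zero_iff_norm.2 (h.norm_eq_one x hx)
      average_eq := fun f hf => by
        rw [Set.ncard_coe_finset, finsum_mem_coe_finset]
        exact h.codeAverage_eq_sphereIntegral hf }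
  right := by
    rw [Set.ncard_coe_finset, h.card_eq, designBound, if_neg (by simp),
      show (2 * (cosineSet X).card + 1) / 2 = (cosineSet X).card by omega]

end IsExtremalAntipodalCode

end Codes

/-! ### Shells of integral lattices -/

/-- The rational numbers `j / k` in the open interval `(-1, 1)`. -/
noncomputable def fractions (k : ℕ) : Finset ℝ :=
  (Finset.Ioo (-(k : ℤ)) k).image fun j : ℤ => (j : ℝ) / k

theorem mem_fractions {k : ℕ} {a : ℝ} :
    a ∈ fractions k ↔ ∃ j : ℤ, -(k : ℤ) < j ∧ j < (k : ℤ) ∧ a = (j : ℝ) / (k : ℝ) := by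
  simp only [fractions, Finset.mem_image, Finset.mem_Ioo, and_assoc, eq_comm (a := a)]

theorem exists_mem_fractions_eq_iff {k : ℕ} {z : ℂ} :
    (∃ α ∈ fractions k, z = α) ↔
      ∃ j : ℤ, -(k : ℤ) < j ∧ j < (k : ℤ) ∧ z = (j : ℂ) / (k : ℂ) := by
  simp [fractions, and_assoc]

theorem card_fractions {k : ℕ} (hk : 1 ≤ k) : (fractions k).card = 2 * k - 1 := by
  have hne : (k : ℝ) ≠ 0 := by positivity
  rw [fractions, Finset.card_image_of_injective, Int.card_Ioo]
  · omega
  · intro i j hij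
    simpa [div_left_inj' hne] using hij

section Shell

variable {n k : ℕ} {L : Submodule ℤ (EuclideanSpace ℝ (Fin n))}

theorem neg_mem_normalizedShell {x : EuclideanSpace ℝ (Fin n)} (hx : x ∈ normalizedShell L k) :
    -x ∈ normalizedShell L k := by
  obtain ⟨y, hy, rfl⟩ := hx
  exact ⟨-y, ⟨L.neg_mem hy.1, by rw [norm_neg, hy.2]⟩, by simp⟩

theorem isAntipodal_normalizedShell : IsAntipodal (normalizedShell L k) :=
  Set.Subset.antisymm (fun _ => neg_mem_normalizedShell) fun x hx =>
    neg_neg x ▸ neg_mem_normalizedShell hx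

theorem norm_eq_one_of_mem_normalizedShell (hk : 1 ≤ k) {x : EuclideanSpace ℝ (Fin n)}
    (hx : x ∈ normalizedShell L k) : ‖x‖ = 1 := by
  obtain ⟨y, hy, rfl⟩ := hx
  have hnorm : ‖y‖ = Real.sqrt k := by rw [← hy.2, Real.sqrt_sq (norm_nonneg y)]
  have hne : Real.sqrt k ≠ 0 := by positivity
  simp only [norm_smul, hnorm, norm_div, norm_one, Real.norm_of_nonneg (Real.sqrt_nonneg _),
    one_div_mul_cancel hne]

theorem inner_mem_fractions (hk : 1 ≤ k) (hL : IsIntegralLattice L)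
    {x y : EuclideanSpace ℝ (Fin n)} (hx : x ∈ normalizedShell L k)
    (hy : y ∈ normalizedShell L k) (hne : x ≠ y) (hne' : x ≠ -y) : ⟪x, y⟫ ∈ fractions k := by
  obtain ⟨hgt, hlt⟩ := inner_mem_Ioo (norm_eq_one_of_mem_normalizedShell hk hx)
    (norm_eq_one_of_mem_normalizedShell hk hy) hne hne'
  obtain ⟨a, ha, rfl⟩ := hx
  obtain ⟨b, hb, rfl⟩ := hy
  obtain ⟨m, hm⟩ := hL a ha.1 b hb.1
  have hpos : (0 : ℝ) < k := by exact_mod_cast hk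
  have hinner : ⟪(1 / Real.sqrt k) • a, (1 / Real.sqrt k) • b⟫ = (m : ℝ) / k := by
    rw [real_inner_smul_left, real_inner_smul_right, hm, ← mul_assoc, div_mul_div_comm,
      Real.mul_self_sqrt hpos.le]
    ring
  simp only [hinner] at hlt hgt ⊢
  rw [div_lt_one hpos] at hlt
  rw [lt_div_iff₀ hpos, neg_one_mul] at hgt
  exact mem_fractions.2 ⟨m, by exact_mod_cast hgt, by exact_mod_cast hlt, rfl⟩

theorem ncard_normalizedShell (hk : 1 ≤ k) :
    (normalizedShell L k).ncard = (shell L k).ncard := by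
  have hne : (1 / Real.sqrt k) ≠ 0 := by positivity
  exact Set.ncard_image_of_injective _ (smul_right_injective _ hne)

theorem exists_isExtremalAntipodalCode (hn : 2 ≤ n) (hk : 1 ≤ k) (hL : IsIntegralLattice L)
    (hcard : (shell L k).ncard = 2 * (n + 2 * k - 2).choose (2 * k - 1)) :
    ∃ X : Finset (EuclideanSpace ℝ (Fin n)), (X : Set (EuclideanSpace ℝ (Fin n))) =
      normalizedShell L k ∧ cosineSet X = fractions k ∧ IsExtremalAntipodalCode X := by
  have hpos : 0 < (n + 2 * k - 2).choose (2 * k - 1) := Nat.choose_pos (by omega)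
  rw [← ncard_normalizedShell hk] at hcard
  obtain ⟨X, hX⟩ := (Set.finite_of_ncard_ne_zero (by omega)).exists_finset_coe
    (s := normalizedShell L k)
  rw [← hX, Set.ncard_coe_finset, show n + 2 * k - 2 = n + (2 * k - 1) - 1 by omega,
    ← card_fractions hk] at hcard
  have hmem (x : EuclideanSpace ℝ (Fin n)) : x ∈ X ↔ x ∈ normalizedShell L k := Set.ext_iff.1 hX x
  have hcode : IsAntipodalCode X :=
    { norm_eq_one := fun x hx => norm_eq_one_of_mem_normalizedShell hk ((hmem x).1 hx)
      neg_mem := fun x hx => (hmem _).2 (neg_mem_normalizedShell ((hmem x).1 hx)) }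
  have hsub : cosineSet X ⊆ fractions k := by
    intro a ha
    obtain ⟨x, hx, y, hy, hne, hne', rfl⟩ := mem_cosineSet.1 ha
    exact inner_mem_fractions hk hL ((hmem x).1 hx) ((hmem y).1 hy) hne hne'
  have hcosine := hcode.cosineSet_eq_of_subset hn hsub hcard
  exact ⟨X, hX, hcosine, hcode, hcosine ▸ hcard⟩

end Shell

end LatticeShell

open LatticeShell

theorem proposition3p1 (n k : ℕ) (hn : 2 ≤ n) (hk : 1 ≤ k)
    (L : Submodule ℤ (EuclideanSpace ℝ (Fin n))) [DiscreteTopology L] [IsZLattice ℝ L]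
    (hL : LatticeShell.IsIntegralLattice L)
    (heq : (LatticeShell.shell L k).ncard = 2 * (n + 2 * k - 2).choose (2 * k - 1)) :
    LatticeShell.innerProductSet (LatticeShell.normalizedShell L k) =
        {-1} ∪ {a : ℝ | ∃ j : ℤ, -(k : ℤ) < j ∧ j < (k : ℤ) ∧ a = (j : ℝ) / (k : ℝ)} ∧
      (LatticeShell.IsAntipodal (LatticeShell.normalizedShell L k) ∧
        LatticeShell.IsTightSphericalDesign (4 * k - 1) (LatticeShell.normalizedShell L k)) ∧
      Polynomial.C (2 * ((n + 2 * k - 2).choose (2 * k - 1) : ℝ)) *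
          LatticeShell.annihilator (LatticeShell.normalizedShell L k) =
        (1 + Polynomial.X) * LatticeShell.gegenbauerSum n (2 * k - 1) ∧
      {z : ℂ | Polynomial.aeval z (LatticeShell.gegenbauerSum n (2 * k - 1)) = 0} =
        {z : ℂ | ∃ j : ℤ, -(k : ℤ) < j ∧ j < (k : ℤ) ∧ z = (j : ℂ) / (k : ℂ)} := by
  obtain ⟨X, hX, hcosine, hcode⟩ := exists_isExtremalAntipodalCode hn hk hL heq
  have hcard : (cosineSet X).card = 2 * k - 1 := hcosine ▸ card_fractions hk
  have hdim : n + (cosineSet X).card - 1 = n + 2 * k - 2 := by omega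
  have hdegree : 2 * (cosineSet X).card + 1 = 4 * k - 1 := by omega
  refine ⟨?_, ⟨isAntipodal_normalizedShell, ?_⟩, ?_, ?_⟩
  · rw [← hX, hcode.innerProductSet_eq hcode.nonempty, hcosine]
    congr 1
    exact Set.ext fun _ => mem_fractions
  · rw [← hX, ← hdegree]
    exact hcode.isTightSphericalDesign
  · rw [← hX, ← hcard, ← hdim]
    exact hcode.C_mul_annihilator_eq hn
  · rw [← hcard]
    ext z
    exact (hcode.aeval_gegenbauerSum_eq_zero_iff hn).trans
      (hcosine ▸ exists_mem_fractions_eq_iff)
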